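/- Let $(\Omega,\mathcal F,\mathsf P)$ be a probability space, $T>0$, and let $\mu$ be a stochastic measure on the Borel $\sigma$-algebra $\mathcal B([0,T])$, i.e. a map from $\mathcal B([0,T])$ to the space $\mathsf L_0(\Omega,\mathcal F,\mathsf P)$ of (classes of) real random variables that is $\sigma$-additive with respect to convergence in probability. Assume that the process $\mu_t=\mu((0,t])$, $0\le t\le T$, has continuous paths (more precisely, fix a version with almost surely continuous paths), and let $V_t$, $0\le t\le T$, be a real process whose paths are almost surely continuous and of bounded variation on $[0,T]$. For random processes $\xi_t,\eta_t$ on $[0,T]$ the Stratonovich integral is $$\int_{(0,T]}\xi_t\circ\mathrm d\eta_t:=\operatorname*{p\,lim}_{n\to\infty}\sum_{k=1}^{j_n}\frac{\xi_{t_{k-1}^n}+\xi_{t_k^n}}2\,\bigl(\eta_{t_k^n}-\eta_{t_{k-1}^n}\bigr),$$ and it is said to exist if this limit in probability exists, and is almost surely the same, for every sequence of partitions $0=t_0^n<t_1^n<\dots<t_{j_n}^n=T$ with $\max_k|t_k^n-t_{k-1}^n|\to0$. Let $f\in C^{1,1}(\mathbb R^2)$, i.e. the partial derivatives $f_1',f_2'$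 exist everywhere and $f,f_1',f_2'$ are continuous on $\mathbb R^2$, and let $g\in C^{2,1}(\mathbb R^2)$, i.e. the partial derivatives $g_1',g_{11}'',g_2'$ exist everywhere and $g,g_1',g_{11}'',g_2'$ are continuous on $\mathbb R^2$ (here the indices $1$ and $2$ denote differentiation in the first and the second variable). Then the Stratonovich integral of $f(\mu_t,V_t)$ with respect to $g(\mu_t,V_t)$ and the Stratonovich integral of $f(\mu_t,V_t)\,g_1'(\mu_t,V_t)$ with respect to $\mu_t$ exist, for almost every $\omega$ the pathwise Riemann--Stieltjes integral of $f(\mu_t,V_t)\,g_2'(\mu_t,V_t)$ with respect to $V_t$ exists, and almost surely $$\int_{(0,T]}f(\mu_t,V_t)\circ\mathrm d g(\mu_t,V_t)=\int_{(0,T]}f(\mu_t,V_t)\,g_1'(\mu_t,V_t)\circ\mathrm d\mu_t+\int_{(0,T]}f(\mu_t,V_t)\,g_2'(\mu_t,V_t)\,\mathrm dV_t .$$ -/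

import Mathlib

open MeasureTheory Filter
open scoped Topology

/-- A stochastic measure: a set function on the σ-algebra of `X`, with values in the space `L₀` of
(classes of) real random variables on `(Ω, P)`, that is σ-additive for convergence in probability.
The values on non-measurable sets carry no information. -/
structure StochasticMeasure (X : Type*) [MeasurableSpace X] {Ω : Type*} [MeasurableSpace Ω]
    (P : Measure Ω) where
  toFun : Set X → (Ω →ₘ[P] ℝ)
  tendsto_iUnion : ∀ A : ℕ → Set X, (∀ i, MeasurableSet (A i)) →
    (∀ i j, i ≠ j → Disjoint (A i) (A j)) →
    TendstoInMeasure P (fun (n : ℕ) (ω : Ω) => (∑ i ∈ Finset.range n, toFun (A i) : Ω →ₘ[P] ℝ) ω)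
      atTop (fun ω => toFun (⋃ i, A i) ω)

/-- `M` is a version, with continuous paths on `[0,T]`, of the process `t ↦ μ((0,t])`. -/
def IsContinuousPathProcess {Ω : Type*} [MeasurableSpace Ω] {P : Measure Ω} {T : ℝ}
    (μ : StochasticMeasure (Set.Icc (0 : ℝ) T) P) (M : ℝ → Ω → ℝ) : Prop :=
  (∀ t ∈ Set.Icc (0 : ℝ) T, M t =ᵐ[P] ⇑(μ.toFun {x | 0 < (x : ℝ) ∧ (x : ℝ) ≤ t})) ∧
    ∀ᵐ ω ∂P, ContinuousOn (fun t => M t ω) (Set.Icc 0 T)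

/-- `V` is a process on `[0,T]` whose paths are continuous and of bounded variation. -/
def IsContinuousBVProcess {Ω : Type*} [MeasurableSpace Ω] (P : Measure Ω) (T : ℝ)
    (V : ℝ → Ω → ℝ) : Prop :=
  (∀ t ∈ Set.Icc (0 : ℝ) T, AEMeasurable (V t) P) ∧
    ∀ᵐ ω ∂P, ContinuousOn (fun t => V t ω) (Set.Icc 0 T) ∧
      BoundedVariationOn (fun t => V t ω) (Set.Icc 0 T)

/-- A partition `0 = pt 0 < pt 1 < ⋯ < pt num = T` of `[0,T]`; the values `pt k` with `k > num`
play no role. -/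
structure IntervalPartition (T : ℝ) where
  num : ℕ
  pt : ℕ → ℝ
  pt_zero : pt 0 = 0
  pt_num : pt num = T
  pt_lt : ∀ k < num, pt k < pt (k + 1)

/-- The largest length of an interval of the partition. -/
noncomputable def IntervalPartition.mesh {T : ℝ} (π : IntervalPartition T) : ℝ :=
  ⨆ k : Fin π.num, (π.pt (k + 1) - π.pt k)

/-- The symmetric (Stratonovich) sum of `ξ` with respect to `η` along a partition. -/
noncomputable def stratonovichSum {Ω : Type*} {T : ℝ} (ξ η : ℝ → Ω → ℝ) (π : IntervalPartition T)
    (ω : Ω) : ℝ :=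
  ∑ k ∈ Finset.range π.num,
    (ξ (π.pt k) ω + ξ (π.pt (k + 1)) ω) / 2 * (η (π.pt (k + 1)) ω - η (π.pt k) ω)

/-- The Stratonovich integral `∫_{(0,T]} ξ ∘ dη` exists and equals `I`: the symmetric sums converge
to `I` in probability along every sequence of partitions whose mesh tends to `0`. -/
def HasStratonovichIntegral {Ω : Type*} [MeasurableSpace Ω] (P : Measure Ω) (T : ℝ)
    (ξ η : ℝ → Ω → ℝ) (I : Ω → ℝ) : Prop :=
  AEMeasurable I P ∧
    ∀ π : ℕ → IntervalPartition T, Tendsto (fun n => (π n).mesh) atTop (𝓝 0) →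
      TendstoInMeasure P (fun n => stratonovichSum ξ η (π n)) atTop I

/-- The Riemann–Stieltjes integral `∫_{(0,T]} φ dv` exists and equals `S`. -/
def HasStieltjesIntegral (T : ℝ) (φ v : ℝ → ℝ) (S : ℝ) : Prop :=
  ∀ ε > 0, ∃ δ > 0, ∀ π : IntervalPartition T, π.mesh < δ → ∀ c : ℕ → ℝ,
    (∀ k < π.num, c k ∈ Set.Icc (π.pt k) (π.pt (k + 1))) →
      |∑ k ∈ Finset.range π.num, φ (c k) * (v (π.pt (k + 1)) - v (π.pt k)) - S| < ε

/-- The partial derivative `f₁'` in the first variable. -/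
noncomputable def partial1 (f : ℝ → ℝ → ℝ) (x v : ℝ) : ℝ := deriv (fun y => f y v) x

/-- The partial derivative `f₂'` in the second variable. -/
noncomputable def partial2 (f : ℝ → ℝ → ℝ) (x v : ℝ) : ℝ := deriv (fun w => f x w) v

/-- The class `C^{1,1}(ℝ²)`: `f₁'` and `f₂'` exist everywhere, and `f`, `f₁'`, `f₂'` are
(jointly) continuous. -/
structure IsC11 (f : ℝ → ℝ → ℝ) : Prop where
  differentiable1 : ∀ v, Differentiable ℝ (fun x => f x v)
  differentiable2 : ∀ x, Differentiable ℝ (fun v => f x v)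
  continuous : Continuous (fun p : ℝ × ℝ => f p.1 p.2)
  continuous_partial1 : Continuous (fun p : ℝ × ℝ => partial1 f p.1 p.2)
  continuous_partial2 : Continuous (fun p : ℝ × ℝ => partial2 f p.1 p.2)

/-- The class `C^{2,1}(ℝ²)`: `g₁'`, `g₁₁''` and `g₂'` exist everywhere, and `g`, `g₁'`, `g₁₁''`,
`g₂'` are (jointly) continuous. No mixed derivative is required. -/
structure IsC21 (g : ℝ → ℝ → ℝ) : Prop extends IsC11 g where
  differentiable11 : ∀ v, Differentiable ℝ (fun x => partial1 g x v)
  continuous_partial11 : Continuous (fun p : ℝ × ℝ => partial1 (partial1 g) p.1 p.2)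

/-! ### Moments of random colourings and a Paley–Zygmund argument. -/

section RandomColouring

/-! Two facts combine: sums of squared increments of a continuous stochastic measure are bounded in
probability, and the symmetric sum integrates exactly up to an error negligible against squared
increments.

Analytic side. For `G` of class `C^{2,1}` the trapezoidal rule gives `ΔG = (G₁' + Ḡ₁')/2 · Δμ + G₂'
· ΔV` up to `o((Δμ)² + |ΔV|)`, the bar meaning the value at the right endpoint
(`IsC21.isSmallDefect`). Apply this to `F(x,v) = ∫₀ˣ f g₁' dy`, for which `F₁' = f g₁'`. The
increments of `F` telescope, so the symmetric sums of `f g₁'` against `μ` converge to `F(μ_T,V_T) -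
F(μ_0,V_0) - ∫ F₂' dV`. Expanding `g` in the same way turns the sums of `f ∘ dg` into those of `f
g₁' ∘ dμ` plus Riemann–Stieltjes sums of `f g₂' dV` (`IsC21.isSmallDefect_mul`). That `F` is
`C^{2,1}` without mixed derivatives of `g` comes from an integration by parts
(`isC21_mulPartialPrimitive`).

Probabilistic side. Only boundedness of the sums of squares is needed, not their convergence
(`sum_sq_bounded_in_probability`). If they were unbounded, a random colouring of the cells would
yield many disjoint unions of cells with values at least `1` in modulus with non-negligible
probability. One of them can be removed while the squares on the remaining set stay unbounded
(`exists_split_off`). Iterating produces infinitely many disjoint sets whose values do not tend to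
`0` in probability, against σ-additivity. Working along an ultrafilter turns "not eventually" into
"eventually not", so finitely many failures can be observed at the same index. -/

lemma sum_fin_succ_pi {α : Type*} [Fintype α] {k : ℕ} (F : (Fin (k + 1) → α) → ℝ) :
    ∑ c, F c = ∑ x : α, ∑ c : Fin k → α, F (Fin.cons x c) := by
  rw [← Fintype.sum_prod_type', ← (Fin.consEquiv (fun _ => α)).sum_comp]
  rfl

/-- First, second and fourth moments of `∑ aᵢ φ(cᵢ)` for a uniformly random colouring `c`. -/
lemma colouring_moments {α : Type*} [Fintype α] (φ : α → ℝ) (h0 : ∑ x, φ x = 0)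
    (h1 : ∀ x, |φ x| ≤ 1) (v : ℝ) (hv : ∑ x, φ x ^ 2 = Fintype.card α * v) (k : ℕ)
    (a : Fin k → ℝ) :
    ∑ c : Fin k → α, ∑ i, a i * φ (c i) = 0 ∧
    ∑ c : Fin k → α, (∑ i, a i * φ (c i)) ^ 2 = Fintype.card α ^ k * (v * ∑ i, a i ^ 2) ∧
    ∑ c : Fin k → α, (∑ i, a i * φ (c i)) ^ 4 ≤
      Fintype.card α ^ k * (3 * (v * ∑ i, a i ^ 2) ^ 2 + v * ∑ i, a i ^ 4) := by
  have h4 : ∑ x, φ x ^ 4 ≤ Fintype.card α * v := by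
    rw [← hv]
    refine Finset.sum_le_sum fun x _ => ?_
    have : φ x ^ 2 ≤ 1 := (sq_le_one_iff_abs_le_one _).2 (h1 x)
    nlinarith [sq_nonneg (φ x)]
  induction k with
  | zero => simp
  | succ k ih =>
    obtain ⟨i1, i2, i4⟩ := ih (fun i => a i.succ)
    set q : ℝ := (Fintype.card α : ℝ) with hq
    set X : (Fin k → α) → ℝ := fun c => ∑ i, a i.succ * φ (c i) with hX
    set s : ℝ := ∑ i, a (Fin.succ i) ^ 2
    set r : ℝ := ∑ i, a (Fin.succ i) ^ 4
    have hcard : ∑ _c : Fin k → α, (1 : ℝ) = q ^ k := by simp [hq]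
    have hq1 : ∑ _x : α, (1 : ℝ) = q := by simp [hq]
    have hq0 : 0 ≤ q := by positivity
    have hqk : 0 ≤ q ^ k := by positivity
    simp only [sum_fin_succ_pi, Fin.sum_univ_succ, Fin.cons_zero, Fin.cons_succ]
    change ∑ x, ∑ c, (a 0 * φ x + X c) = 0 ∧ ∑ x, ∑ c, (a 0 * φ x + X c) ^ 2 = _ ∧
      ∑ x, ∑ c, (a 0 * φ x + X c) ^ 4 ≤ _
    change ∑ c, X c = 0 at i1
    change ∑ c, X c ^ 2 = q ^ k * (v * s) at i2
    change ∑ c, X c ^ 4 ≤ q ^ k * (3 * (v * s) ^ 2 + v * r) at i4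
    have prod : ∀ (u : α → ℝ) (w : (Fin k → α) → ℝ),
        ∑ x, ∑ c, u x * w c = (∑ x, u x) * ∑ c, w c := fun u w => by
      rw [Finset.sum_mul_sum]
    refine ⟨?_, ?_, ?_⟩
    · have : ∀ x c, a 0 * φ x + X c = (a 0 * φ x) * 1 + 1 * X c := fun x c => by ring
      simp only [this, Finset.sum_add_distrib]
      rw [prod (fun x => a 0 * φ x) (fun _ => 1), prod (fun _ => 1) X, i1, ← Finset.mul_sum, h0]
      ring
    · have : ∀ x c, (a 0 * φ x + X c) ^ 2 =
          (a 0 ^ 2 * φ x ^ 2) * 1 + (2 * a 0 * φ x) * X c + 1 * X c ^ 2 := fun x c => by ring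
      simp only [this, Finset.sum_add_distrib]
      rw [prod (fun x => a 0 ^ 2 * φ x ^ 2) (fun _ => 1), prod (fun x => 2 * a 0 * φ x) X,
        prod (fun _ => 1) (fun c => X c ^ 2), i1, i2, ← Finset.mul_sum, hv, hcard, hq1]
      ring
    · have : ∀ x c, (a 0 * φ x + X c) ^ 4 =
          (a 0 ^ 4 * φ x ^ 4) * 1 + (4 * a 0 ^ 3 * φ x ^ 3) * X c
            + (6 * a 0 ^ 2 * φ x ^ 2) * X c ^ 2 + (4 * a 0 * φ x) * X c ^ 3 + 1 * X c ^ 4 :=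
        fun x c => by ring
      simp only [this, Finset.sum_add_distrib]
      rw [prod (fun x => a 0 ^ 4 * φ x ^ 4) (fun _ => 1), prod (fun x => 4 * a 0 ^ 3 * φ x ^ 3) X,
        prod (fun x => 6 * a 0 ^ 2 * φ x ^ 2) (fun c => X c ^ 2),
        prod (fun x => 4 * a 0 * φ x) (fun c => X c ^ 3),
        prod (fun _ => 1) (fun c => X c ^ 4), i1, i2, hcard, hq1]
      simp only [← Finset.mul_sum]
      rw [h0, hv]
      have e1 : a 0 ^ 4 * (∑ x, φ x ^ 4) * q ^ k ≤ a 0 ^ 4 * (q * v) * q ^ k := by gcongr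
      have e2 : q * ∑ c, X c ^ 4 ≤ q * (q ^ k * (3 * (v * s) ^ 2 + v * r)) := by gcongr
      -- The terms odd in `φ` or in `X` vanish because `∑ φ = 0` and `∑ X = 0`. The cross term `6
      -- a₀² φ² X²` is exactly the one in `3 (v (a₀² + s))²`, and `e3` is the unused square `3 v²
      -- a₀⁴`.
      have e3 : 0 ≤ q ^ (k + 1) * (3 * v ^ 2 * (a 0 ^ 2) ^ 2) := by positivity
      change _ ≤ q ^ (k + 1) * (3 * (v * (a 0 ^ 2 + s)) ^ 2 + v * (a 0 ^ 4 + r))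
      rw [pow_succ q k] at e3 ⊢
      linarith

/-- The Paley–Zygmund inequality for the uniform distribution on a finite set. -/
lemma card_le_of_moments {C : Type*} [Fintype C] (X : C → ℝ) (v : ℝ) (hv : 8 ≤ v)
    (h2 : ∑ c, X c ^ 2 = Fintype.card C * v)
    (h4 : ∑ c, X c ^ 4 ≤ Fintype.card C * (4 * v ^ 2)) :
    (Fintype.card C : ℝ) / 16 ≤ (Finset.univ.filter fun c => 2 ≤ |X c|).card := by
  classical
  set G := Finset.univ.filter fun c => 2 ≤ |X c|
  set n : ℝ := (Fintype.card C : ℝ)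
  have hn : 0 ≤ n := by positivity
  rcases hn.eq_or_lt with h | hn
  · rw [← h]; simp
  have hsplit := Finset.sum_filter_add_sum_filter_not Finset.univ (fun c => 2 ≤ |X c|)
    (fun c => X c ^ 2)
  have hsmall : ∑ c ∈ Finset.univ.filter (fun c => ¬ 2 ≤ |X c|), X c ^ 2 ≤ n * 4 := by
    calc _ ≤ ∑ c ∈ Finset.univ.filter (fun c => ¬ 2 ≤ |X c|), (4 : ℝ) := by
          refine Finset.sum_le_sum fun c hc => ?_
          have : |X c| < 2 := by simpa using hc
          rw [← sq_abs]; nlinarith [abs_nonneg (X c)]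
      _ ≤ ∑ c : C, (4 : ℝ) := Finset.sum_le_univ_sum_of_nonneg (by simp)
      _ = n * 4 := by simp [n]
  -- Values below `2` carry at most `4n ≤ nv/2` of the second moment, since `8 ≤ v`. Cauchy–Schwarz
  -- on `G` then gives `(nv/2)² ≤ |G| · 4nv²`, that is `|G| ≥ n/16`.
  have hbig : n * v / 2 ≤ ∑ c ∈ G, X c ^ 2 := by nlinarith
  have hcs := sq_sum_le_card_mul_sum_sq (s := G) (f := fun c => X c ^ 2)
  have h4' : ∑ c ∈ G, (X c ^ 2) ^ 2 ≤ n * (4 * v ^ 2) := by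
    refine le_trans ?_ h4
    refine (Finset.sum_le_univ_sum_of_nonneg fun c => by positivity).trans (le_of_eq ?_)
    exact Finset.sum_congr rfl fun c _ => by ring
  have h5 : (n * v / 2) ^ 2 ≤ G.card * (n * (4 * v ^ 2)) := by
    calc _ ≤ (∑ c ∈ G, X c ^ 2) ^ 2 := by gcongr
      _ ≤ _ := hcs
      _ ≤ _ := by gcongr
  have h6 : 0 < n * v ^ 2 := by positivity
  have h7 : n * v ^ 2 * (n / 4) ≤ n * v ^ 2 * (4 * G.card) := by nlinarith
  have := le_of_mul_le_mul_left h7 h6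
  linarith

/-- The difference of the indicators of the two halves of colour `i`. -/
def halfDiff {N : ℕ} (i : Fin N) (x : Fin N × Bool) : ℝ :=
  if x = (i, true) then 1 else if x = (i, false) then -1 else 0

/-- Subtracting the two halves of a colour centres the random sum, whatever `∑ aₗ` is. Among `2N`
equally likely values `halfDiff i` is `±1` at two and `0` elsewhere, so it has variance `1/N`, and
the sum has variance at least `8`. -/
lemma card_colourings {N k : ℕ} (i : Fin N) (a : Fin k → ℝ) (ha : ∀ l, |a l| ≤ 1)
    (hs : 8 * (N : ℝ) ≤ ∑ l, a l ^ 2) :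
    (Fintype.card (Fin k → Fin N × Bool) : ℝ) / 16 ≤
      (Finset.univ.filter fun c : Fin k → Fin N × Bool =>
        2 ≤ |∑ l, a l * halfDiff i (c l)|).card := by
  classical
  have hN : (0 : ℝ) < N := by exact_mod_cast i.pos
  have hsq : ∀ x : Fin N × Bool, halfDiff i x ^ 2 =
      (if x = (i, true) then 1 else 0) + (if x = (i, false) then 1 else 0) := by
    intro x; unfold halfDiff; split_ifs <;> simp_all
  have hlin : ∀ x : Fin N × Bool, halfDiff i x =
      (if x = (i, true) then 1 else 0) - (if x = (i, false) then 1 else 0) := by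
    intro x; unfold halfDiff; split_ifs <;> simp_all
  obtain ⟨-, h2, h4⟩ := colouring_moments (halfDiff i)
    (by simp [hlin, Finset.sum_sub_distrib])
    (by intro x; unfold halfDiff; split_ifs <;> simp) (1 / N : ℝ)
    (by simp only [hsq, Finset.sum_add_distrib]; simp; field_simp; norm_num) k a
  have hv : 8 ≤ 1 / (N : ℝ) * ∑ l, a l ^ 2 := by
    rw [div_mul_eq_mul_div, one_mul, le_div_iff₀ hN]; exact hs
  refine card_le_of_moments _ (1 / (N : ℝ) * ∑ l, a l ^ 2) hv ?_ ?_
  · rw [h2]; simp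
  · refine h4.trans ?_
    -- With `V = (1/N) ∑ aₗ²`, the fourth moment is at most `3V² + V ≤ 4V²`, as `V ≥ 1`.
    have h5 : ∑ l, a l ^ 4 ≤ ∑ l, a l ^ 2 := by
      refine Finset.sum_le_sum fun l _ => ?_
      have : a l ^ 2 ≤ 1 := (sq_le_one_iff_abs_le_one _).2 (ha l)
      nlinarith [sq_nonneg (a l)]
    have h6 : 1 / (N : ℝ) * ∑ l, a l ^ 4 ≤ 1 / (N : ℝ) * ∑ l, a l ^ 2 := by gcongr
    have h7 : ((Fintype.card (Fin k → Fin N × Bool) : ℕ) : ℝ) =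
      (Fintype.card (Fin N × Bool) : ℝ) ^ k := by simp
    rw [h7]
    gcongr
    nlinarith

/-- If `∑ aₗ²` is large with probability at least `d` and the `aₗ` are small, then some colouring
has many colour classes whose sum is not small. -/
lemma exists_colouring {Ω : Type*} [MeasurableSpace Ω] (P : Measure Ω) [IsProbabilityMeasure P]
    {N k : ℕ} (hN : 0 < N) (a : Fin k → Ω → ℝ) (ha : ∀ l, Measurable (a l)) (G : Set Ω)
    (hG : MeasurableSet G) (h1 : ∀ ω ∈ G, ∀ l, |a l ω| ≤ 1)
    (h2 : ∀ ω ∈ G, 8 * (N : ℝ) ≤ ∑ l, a l ω ^ 2) :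
    ∃ c : Fin k → Fin N × Bool, N * P.real G / 16 ≤
      ∑ j, P.real {ω | 1 ≤ |∑ l, if c l = j then a l ω else 0|} := by
  classical
  set C := Fin k → Fin N × Bool
  have : NeZero N := ⟨hN.ne'⟩
  set Y : C → Fin N → Set Ω := fun c i => {ω | 2 ≤ |∑ l, a l ω * halfDiff i (c l)|} with hY
  have hYm : ∀ c i, MeasurableSet (Y c i) := fun c i =>
    measurableSet_le measurable_const
      (Finset.measurable_sum _ fun l _ => (ha l).mul_const _).abs
  have hfub : ∀ i, Fintype.card C / 16 * P.real G ≤ ∑ c, P.real (Y c i) := by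
    intro i
    have e1 : ∀ c, P.real (Y c i) = ∫ ω, (Y c i).indicator (fun _ => (1 : ℝ)) ω ∂P := fun c => by
      rw [integral_indicator (hYm c i)]; simp
    have hint : ∀ c, Integrable ((Y c i).indicator (fun _ => (1 : ℝ))) P := fun c =>
      (integrable_const 1).indicator (hYm c i)
    simp only [e1]
    rw [← integral_finsetSum _ fun c _ => hint c]
    have e2 : Fintype.card C / 16 * P.real G =
        ∫ ω, G.indicator (fun _ => (Fintype.card C / 16 : ℝ)) ω ∂P := by
      rw [integral_indicator hG]; simp [mul_comm]
    rw [e2]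
    refine integral_mono ((integrable_const _).indicator hG)
      (integrable_finsetSum _ fun c _ => hint c) fun ω => ?_
    by_cases hω : ω ∈ G
    · have := card_colourings i (fun l => a l ω) (h1 ω hω) (h2 ω hω)
      simp only [Set.indicator_of_mem hω]
      refine this.trans (le_of_eq ?_)
      rw [Finset.card_filter]
      push_cast
      refine Finset.sum_congr rfl fun c _ => ?_
      simp [Set.indicator_apply, hY]
    · simp only [Set.indicator_of_notMem hω]
      exact Finset.sum_nonneg fun c _ => Set.indicator_nonneg (fun _ _ => zero_le_one) _
  -- Averaging over all colourings: some colouring does at least as well as the mean.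
  have htot : ∑ c : C, (N * P.real G / 16) ≤ ∑ c : C, ∑ i, P.real (Y c i) := by
    rw [Finset.sum_comm]
    calc ∑ c : C, (N * P.real G / 16 : ℝ) = ∑ i : Fin N, Fintype.card C / 16 * P.real G := by
          simp only [Finset.sum_const, Finset.card_univ, nsmul_eq_mul, Fintype.card_fin]; ring
      _ ≤ _ := Finset.sum_le_sum fun i _ => hfub i
  obtain ⟨c, -, hc⟩ := Finset.exists_le_of_sum_le (Finset.univ_nonempty (α := C)) htot
  refine ⟨c, hc.trans ?_⟩
  rw [Fintype.sum_prod_type]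
  refine Finset.sum_le_sum fun i _ => ?_
  rw [Fintype.sum_bool]
  refine (measureReal_mono ?_).trans (measureReal_union_le _ _)
  intro ω hω
  have e : ∑ l, a l ω * halfDiff i (c l) = (∑ l, if c l = (i, true) then a l ω else 0)
      - ∑ l, if c l = (i, false) then a l ω else 0 := by
    rw [← Finset.sum_sub_distrib]
    refine Finset.sum_congr rfl fun l _ => ?_
    unfold halfDiff
    split_ifs <;> simp_all
  simp only [hY, Set.mem_ofPred_eq, e] at hω
  simp only [Set.mem_union, Set.mem_ofPred_eq]
  -- If the two halves differ by at least `2`, one of them is at least `1` in modulus.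
  by_contra! hcon
  have := abs_sub (∑ l, if c l = (i, true) then a l ω else 0) (∑ l, if c l = (i, false) then a l ω else 0)
  linarith [hcon.1, hcon.2]

end RandomColouring

/-! ### Sums of squares of an exhaustive set function are bounded in probability. -/

section BoundedSquares

variable {X Ω : Type*}

open Classical in
/-- The sum of the squares of the values on those cells of the `n`-th family that lie in `R`. -/
noncomputable def innerSquares (m : Set X → Ω → ℝ) (num : ℕ → ℕ) (A : ℕ → ℕ → Set X) (n : ℕ)
    (R : Set X) (ω : Ω) : ℝ :=
  ∑ k ∈ (Finset.range (num n)).filter (fun k => A n k ⊆ R), m (A n k) ω ^ 2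

variable {m : Set X → Ω → ℝ} {num : ℕ → ℕ} {A : ℕ → ℕ → Set X}

lemma innerSquares_mono (n : ℕ) {R R' : Set X} (h : R ⊆ R') (ω : Ω) :
    innerSquares m num A n R ω ≤ innerSquares m num A n R' ω := by
  classical
  refine Finset.sum_le_sum_of_subset_of_nonneg (fun k hk => ?_) fun _ _ _ => sq_nonneg _
  simp only [Finset.mem_filter] at hk ⊢
  exact ⟨hk.1, hk.2.trans h⟩

/-- Splitting off a union `B` of cells of the `r`-th family. -/
lemma innerSquares_le_add (r : ℕ) (D : ℕ)
    (hD : ∀ n, ∀ s : Finset ℕ, (∀ k ∈ s, k < num n) →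
      (∀ k ∈ s, ∀ j < num r, ¬ A n k ⊆ A r j) → s.card ≤ D)
    (R B : Set X) (hB : ∀ j < num r, A r j ⊆ B ∨ Disjoint (A r j) B) (n : ℕ) (ω : Ω) (η : ℝ)
    (hη : ∀ k < num n, |m (A n k) ω| ≤ η) :
    innerSquares m num A n R ω ≤
      innerSquares m num A n (R \ B) ω + innerSquares m num A n B ω + D * η ^ 2 := by
  classical
  set s := (Finset.range (num n)).filter (fun k => A n k ⊆ R) with hs
  set s1 := (Finset.range (num n)).filter (fun k => A n k ⊆ R \ B) with hs1
  set s2 := (Finset.range (num n)).filter (fun k => A n k ⊆ B) with hs2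
  set s3 := (Finset.range (num n)).filter (fun k => ∀ j < num r, ¬ A n k ⊆ A r j) with hs3
  -- A cell inside a cell of the `r`-th family lies in `B` or misses it. At most `D` cells are not
  -- of this kind, and each contributes at most `η²`.
  have hsub : s ⊆ (s1 ∪ s2) ∪ s3 := by
    intro k hk
    simp only [hs, hs1, hs2, hs3, Finset.mem_union, Finset.mem_filter] at hk ⊢
    by_cases h : ∃ j < num r, A n k ⊆ A r j
    · obtain ⟨j, hj, hkj⟩ := h
      left
      rcases hB j hj with h | h
      · exact Or.inr ⟨hk.1, hkj.trans h⟩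
      · exact Or.inl ⟨hk.1, Set.subset_sdiff.2 ⟨hk.2, h.mono_left hkj⟩⟩
    · push Not at h
      exact Or.inr ⟨hk.1, h⟩
  have hnn : ∀ t : Finset ℕ, 0 ≤ ∑ k ∈ t, m (A n k) ω ^ 2 := fun t =>
    Finset.sum_nonneg fun _ _ => sq_nonneg _
  have hun : ∀ t t' : Finset ℕ, ∑ k ∈ t ∪ t', m (A n k) ω ^ 2 ≤
      ∑ k ∈ t, m (A n k) ω ^ 2 + ∑ k ∈ t', m (A n k) ω ^ 2 := fun t t' => by
    rw [← Finset.sum_union_inter]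
    linarith [hnn (t ∩ t')]
  have h3 : ∑ k ∈ s3, m (A n k) ω ^ 2 ≤ D * η ^ 2 := by
    calc ∑ k ∈ s3, m (A n k) ω ^ 2 ≤ ∑ k ∈ s3, η ^ 2 := by
          refine Finset.sum_le_sum fun k hk => ?_
          have := hη k (by simp only [hs3, Finset.mem_filter, Finset.mem_range] at hk; exact hk.1)
          rw [← sq_abs]
          gcongr
      _ = s3.card * η ^ 2 := by simp
      _ ≤ _ := by
          have : s3.card ≤ D := hD n s3
            (fun k hk => by simp only [hs3, Finset.mem_filter, Finset.mem_range] at hk; exact hk.1)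
            (fun k hk => by simp only [hs3, Finset.mem_filter, Finset.mem_range] at hk; exact hk.2)
          gcongr
  have h4 := Finset.sum_le_sum_of_subset_of_nonneg (f := fun k => m (A n k) ω ^ 2) hsub
    fun _ _ _ => sq_nonneg _
  have h5 := hun (s1 ∪ s2) s3
  have h6 := hun s1 s2
  change ∑ k ∈ s, m (A n k) ω ^ 2 ≤ ∑ k ∈ s1, m (A n k) ω ^ 2 + ∑ k ∈ s2, m (A n k) ω ^ 2 + _
  linarith

variable [MeasurableSpace X] [MeasurableSpace Ω] {P : Measure Ω}

/-- A finitely additive exhaustive set function with values in the random variables. -/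
structure IsExhaustive (P : Measure Ω) (m : Set X → Ω → ℝ) : Prop where
  measurable : ∀ A, Measurable (m A)
  empty : m ∅ =ᵐ[P] 0
  union : ∀ A B, MeasurableSet A → MeasurableSet B → Disjoint A B →
    m (A ∪ B) =ᵐ[P] fun ω => m A ω + m B ω
  exhaustive : ∀ B : ℕ → Set X, (∀ i, MeasurableSet (B i)) → (∀ i j, i ≠ j → Disjoint (B i) (B j)) →
    Tendsto (fun n => P.real {ω | 1 ≤ |m (B n) ω|}) atTop (𝓝 0)

/-- A sequence of finite families of disjoint sets, such that the number of sets of the `n`-th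
family that are not contained in a set of the `r`-th family is bounded in `n`. -/
structure IsCellSequence (num : ℕ → ℕ) (A : ℕ → ℕ → Set X) : Prop where
  measurable : ∀ n k, MeasurableSet (A n k)
  disjoint : ∀ n, ∀ k < num n, ∀ l < num n, k ≠ l → Disjoint (A n k) (A n l)
  cut : ∀ r, ∃ D : ℕ, ∀ n, ∀ s : Finset ℕ, (∀ k ∈ s, k < num n) →
    (∀ k ∈ s, ∀ j < num r, ¬ A n k ⊆ A r j) → s.card ≤ D

lemma IsExhaustive.biUnion (hm : IsExhaustive P m) {ι : Type*} (s : Finset ι) (B : ι → Set X)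
    (hB : ∀ i ∈ s, MeasurableSet (B i))
    (hd : ∀ i ∈ s, ∀ j ∈ s, i ≠ j → Disjoint (B i) (B j)) :
    m (⋃ i ∈ s, B i) =ᵐ[P] fun ω => ∑ i ∈ s, m (B i) ω := by
  classical
  induction s using Finset.induction_on with
  | empty =>
    simp only [Finset.notMem_empty, Set.iUnion_of_empty, Set.iUnion_empty, Finset.sum_empty]
    exact hm.empty
  | insert i s hi ih =>
    have h1 := ih (fun j hj => hB j (Finset.mem_insert_of_mem hj)) fun j hj k hk =>
      hd j (Finset.mem_insert_of_mem hj) k (Finset.mem_insert_of_mem hk)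
    have h2 := hm.union (B i) (⋃ j ∈ s, B j) (hB i (Finset.mem_insert_self _ _))
      (s.measurableSet_biUnion fun j hj => hB j (Finset.mem_insert_of_mem hj))
      (by
        simp only [Set.disjoint_iUnion_right]
        intro j hj
        exact hd i (Finset.mem_insert_self _ _) j (Finset.mem_insert_of_mem hj)
          fun h => hi (h ▸ hj))
    rw [Finset.set_biUnion_insert]
    filter_upwards [h1, h2] with ω h1 h2
    rw [h2, h1, Finset.sum_insert hi]

lemma measurable_innerSquares (hm : IsExhaustive P m) (n : ℕ) (R : Set X) :
    Measurable (innerSquares m num A n R) :=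
  Finset.measurable_sum _ fun _ _ => (hm.measurable _).pow_const 2

/-- Some sets `B j`, out of a long list of disjoint unions of cells inside `R`, can be removed
from `R` with almost no loss for the probability that the inner squares are large. -/
lemma exists_removable [IsProbabilityMeasure P] (hm : IsExhaustive P m)
    (hA : IsCellSequence num A) (U : Ultrafilter ℕ)
    (hsmall : ∀ η > 0, Tendsto (fun n => P.real {ω | ∃ k < num n, η < |m (A n k) ω|}) U (𝓝 0))
    (R : Set X) {d e : ℝ} (he : 0 < e)
    (hR : ∀ K : ℝ, ∀ᶠ n in (U : Filter ℕ), d ≤ P.real {ω | K < innerSquares m num A n R ω})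
    (r : ℕ) {ι : Type*} (J : Finset ι) (hJ : 2 / e < J.card) (B : ι → Set X)
    (hBR : ∀ j ∈ J, B j ⊆ R) (hBd : ∀ i ∈ J, ∀ j ∈ J, i ≠ j → Disjoint (B i) (B j))
    (hB : ∀ i ∈ J, ∀ j < num r, A r j ⊆ B i ∨ Disjoint (A r j) (B i)) :
    ∃ j ∈ J, ∀ K : ℝ, ∀ᶠ n in (U : Filter ℕ),
      d - e ≤ P.real {ω | K < innerSquares m num A n (R \ B j) ω} := by
  classical
  -- If no `B j` were removable, each `j` would give an event `W j` of probability at least `e/2`,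
  -- where the squares on `R` are large but those on `R \ B j` are not. These events turn out to be
  -- disjoint, which forces `|J| ≤ 2/e`.
  by_contra! hcon
  have hcon' : ∀ j, ∃ K : ℝ, j ∈ J → ∀ᶠ n in (U : Filter ℕ),
      P.real {ω | K < innerSquares m num A n (R \ B j) ω} < d - e := by
    intro j
    by_cases hj : j ∈ J
    · obtain ⟨K, hK⟩ := hcon j hj
      exact ⟨K, fun _ => hK⟩
    · exact ⟨0, fun h => absurd h hj⟩
  choose K hK using hcon'
  obtain ⟨K', hK'⟩ := (J.image K).bddAbove
  set L := max K' 0 with hL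
  have hKL : ∀ j ∈ J, K j ≤ L := fun j hj =>
    (hK' (Finset.mem_coe.2 (Finset.mem_image_of_mem K hj))).trans (le_max_left _ _)
  obtain ⟨D, hD⟩ := hA.cut r
  obtain ⟨η, hη, hDη⟩ : ∃ η : ℝ, 0 < η ∧ D * η ^ 2 ≤ 1 := by
    refine ⟨1 / (D + 1), by positivity, ?_⟩
    rw [div_pow, one_pow, mul_one_div, div_le_one (by positivity)]
    nlinarith [(Nat.cast_nonneg D : (0 : ℝ) ≤ D)]
  have ev1 : ∀ᶠ n in (U : Filter ℕ), ∀ j ∈ J,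
      P.real {ω | K j < innerSquares m num A n (R \ B j) ω} < d - e :=
    (Filter.eventually_all_finset J).2 fun j hj => hK j hj
  have ev2 := hR (2 * L + 1)
  have ev3 := (hsmall η hη).eventually (gt_mem_nhds (half_pos he))
  obtain ⟨n, h1, h2, h3⟩ := (ev1.and (ev2.and ev3)).exists
  set E := {ω | 2 * L + 1 < innerSquares m num A n R ω} with hE
  set Z := {ω | ∃ k < num n, η < |m (A n k) ω|} with hZ
  set G : ι → Set Ω := fun j => {ω | K j < innerSquares m num A n (R \ B j) ω} with hG
  have hZm : MeasurableSet Z := by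
    have : Z = ⋃ k ∈ Finset.range (num n), {ω | η < |m (A n k) ω|} := by
      ext ω; simp [hZ]
    rw [this]
    exact Finset.measurableSet_biUnion _ fun k _ =>
      measurableSet_lt measurable_const (hm.measurable _).abs
  have hEm : MeasurableSet E := measurableSet_lt measurable_const (measurable_innerSquares hm n R)
  have hGm : ∀ j, MeasurableSet (G j) := fun j =>
    measurableSet_lt measurable_const (measurable_innerSquares hm n _)
  set W : ι → Set Ω := fun j => (E \ Z) \ G j with hW
  have hWP : ∀ j ∈ J, e / 2 ≤ P.real (W j) := by
    intro j hj
    have a1 : P.real E ≤ P.real (W j) + P.real Z + P.real (G j) := by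
      refine (measureReal_mono (s₂ := (W j ∪ Z) ∪ G j) ?_).trans
        ((measureReal_union_le _ _).trans (by gcongr; exact measureReal_union_le _ _))
      intro ω hω
      simp only [hW, Set.mem_union, Set.mem_sdiff]
      tauto
    have := h1 j hj
    change P.real (G j) < d - e at this
    linarith
  -- On `W i ∩ W j` the squares on `R \ B i` are at most `L`. So are those on `B i ⊆ R \ B j`. With
  -- at most `1` from the cut cells this contradicts the threshold `2L + 1`.
  have hWd : ∀ i ∈ J, ∀ j ∈ J, i ≠ j → Disjoint (W i) (W j) := by
    intro i hi j hj hij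
    rw [Set.disjoint_left]
    rintro ω ⟨⟨hωE, hωZ⟩, hωi⟩ ⟨-, hωj⟩
    simp only [hE, Set.mem_ofPred_eq] at hωE
    simp only [hZ, Set.mem_ofPred_eq, not_exists, not_and, not_lt] at hωZ
    simp only [hG, Set.mem_ofPred_eq, not_lt] at hωi hωj
    have b1 := innerSquares_le_add r D hD R (B i) (hB i hi) n ω η hωZ
    have b2 : innerSquares m num A n (B i) ω ≤ innerSquares m num A n (R \ B j) ω :=
      innerSquares_mono n (Set.subset_sdiff.2 ⟨hBR i hi, hBd i hi j hj hij⟩) ω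
    linarith [hKL i hi, hKL j hj]
  have hsum : ∑ j ∈ J, P.real (W j) ≤ 1 := by
    rw [← measureReal_biUnion_finset (fun i hi j hj hij => hWd i hi j hj hij)
      fun j _ => (hEm.diff hZm).diff (hGm j)]
    exact measureReal_le_one
  have hlow : J.card * (e / 2) ≤ ∑ j ∈ J, P.real (W j) := by
    rw [← nsmul_eq_mul, ← Finset.sum_const]
    exact Finset.sum_le_sum hWP
  rw [div_lt_iff₀ he] at hJ
  linarith

/-- A set of non-negligible value can be split off from a set with unbounded inner squares. -/
lemma exists_split_off [IsProbabilityMeasure P] (hm : IsExhaustive P m)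
    (hA : IsCellSequence num A) (U : Ultrafilter ℕ)
    (hsmall : ∀ η > 0, Tendsto (fun n => P.real {ω | ∃ k < num n, η < |m (A n k) ω|}) U (𝓝 0))
    (R : Set X) {d e : ℝ} (hd : 0 < d) (he : 0 < e)
    (hR : ∀ K : ℝ, ∀ᶠ n in (U : Filter ℕ), d ≤ P.real {ω | K < innerSquares m num A n R ω}) :
    ∃ B ⊆ R, MeasurableSet B ∧ d / 128 ≤ P.real {ω | 1 ≤ |m B ω|} ∧
      ∀ K : ℝ, ∀ᶠ n in (U : Filter ℕ),
        d - e ≤ P.real {ω | K < innerSquares m num A n (R \ B) ω} := by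
  classical
  obtain ⟨N, hN⟩ := exists_nat_gt (max 0 (2 / e * (64 / d)))
  have hN0 : (0 : ℝ) < N := (le_max_left _ _).trans_lt hN
  have hNe : 2 / e < N * d / 64 := by
    have := (le_max_right _ _).trans_lt hN
    rw [lt_div_iff₀ (by norm_num)]
    calc 2 / e * 64 = 2 / e * (64 / d) * d := by field_simp
      _ < N * d := by gcongr
  obtain ⟨r, h1, h2⟩ := ((hR (8 * N)).and
    ((hsmall 1 one_pos).eventually (gt_mem_nhds (half_pos hd)))).exists
  set E := {ω | 8 * N < innerSquares m num A r R ω} with hE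
  set Z := {ω | ∃ k < num r, 1 < |m (A r k) ω|} with hZ
  have hZm : MeasurableSet Z := by
    have : Z = ⋃ k ∈ Finset.range (num r), {ω | 1 < |m (A r k) ω|} := by
      ext ω; simp [hZ]
    rw [this]
    exact Finset.measurableSet_biUnion _ fun k _ =>
      measurableSet_lt measurable_const (hm.measurable _).abs
  have hEm : MeasurableSet E := measurableSet_lt measurable_const (measurable_innerSquares hm r R)
  set a : Fin (num r) → Ω → ℝ := fun l ω => if A r l ⊆ R then m (A r l) ω else 0 with ha
  have hsum : ∀ ω, ∑ l, a l ω ^ 2 = innerSquares m num A r R ω := by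
    intro ω
    unfold innerSquares
    rw [Finset.sum_filter, Finset.sum_range]
    refine Finset.sum_congr rfl fun l _ => ?_
    simp only [ha]
    split_ifs <;> simp
  obtain ⟨c, hc⟩ := exists_colouring P (by exact_mod_cast hN0) a
    (fun l => by
      simp only [ha]
      split_ifs
      · exact hm.measurable _
      · exact measurable_const) (E \ Z) (hEm.diff hZm)
    (by
      rintro ω ⟨-, hω⟩ l
      simp only [hZ, Set.mem_ofPred_eq, not_exists, not_and, not_lt] at hω
      simp only [ha]
      split_ifs
      · exact hω l l.2
      · simp)
    (by
      rintro ω ⟨hω, -⟩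
      rw [hsum]
      exact le_of_lt hω)
  have hEZ : d / 2 ≤ P.real (E \ Z) := by
    have := le_measureReal_sdiff (μ := P) (s₁ := E) (s₂ := Z)
    linarith
  set s : Fin N × Bool → Finset (Fin (num r)) := fun j =>
    Finset.univ.filter fun l => c l = j ∧ A r l ⊆ R with hs
  set B : Fin N × Bool → Set X := fun j => ⋃ l ∈ s j, A r l with hB
  have hBm : ∀ j, m (B j) =ᵐ[P] fun ω => ∑ l, if c l = j then a l ω else 0 := by
    intro j
    filter_upwards [hm.biUnion (s j) (fun l => A r l) (fun l _ => hA.measurable r l)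
      (fun i _ j _ hij => hA.disjoint r i i.2 j j.2 fun h => hij (Fin.ext h))] with ω hω
    simp only [hB]
    rw [hω, hs, Finset.sum_filter]
    refine Finset.sum_congr rfl fun l _ => ?_
    simp only [ha]
    split_ifs <;> tauto
  have hBP : ∀ j, P.real {ω | 1 ≤ |∑ l, if c l = j then a l ω else 0|} =
      P.real {ω | 1 ≤ |m (B j) ω|} := by
    intro j
    refine measureReal_congr ?_
    filter_upwards [hBm j] with ω hω
    simp only [eq_iff_iff]
    change (1 ≤ _) ↔ (1 ≤ _)
    rw [hω]
  simp only [hBP] at hc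
  set J := Finset.univ.filter fun j : Fin N × Bool => d / 128 ≤ P.real {ω | 1 ≤ |m (B j) ω|} with hJ
  -- The `2N` probabilities sum to at least `N (d/2) / 16 = Nd/32`. Those below `d/128` account for
  -- at most `Nd/64`, so at least `Nd/64` colours remain; this dictated the choice of `N`.
  have hJc : 2 / e < J.card := by
    refine hNe.trans_le ?_
    have u1 : ∑ j, P.real {ω | 1 ≤ |m (B j) ω|} ≤
        ∑ j : Fin N × Bool, ((if j ∈ J then (1 : ℝ) else 0) + d / 128) := by
      refine Finset.sum_le_sum fun j _ => ?_
      by_cases hj : j ∈ J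
      · rw [if_pos hj]
        have : P.real {ω | 1 ≤ |m (B j) ω|} ≤ 1 := measureReal_le_one
        linarith
      · rw [if_neg hj]
        simp only [hJ, Finset.mem_filter, Finset.mem_univ, true_and, not_le] at hj
        linarith
    rw [Finset.sum_add_distrib, Finset.sum_const, Finset.sum_ite_mem, Finset.univ_inter,
      Finset.sum_const, Finset.card_univ] at u1
    simp only [nsmul_eq_mul, mul_one, Fintype.card_prod, Fintype.card_fin, Fintype.card_bool,
      Nat.cast_mul, Nat.cast_ofNat] at u1
    have : N * (d / 2) / 16 ≤ N * P.real (E \ Z) / 16 := by gcongr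
    linarith
  obtain ⟨j, hj, hjK⟩ := exists_removable hm hA U hsmall R he hR r J hJc B
    (fun j _ => by
      simp only [hB, Set.iUnion_subset_iff]
      intro l hl
      simp only [hs, Finset.mem_filter] at hl
      exact hl.2.2)
    (fun i _ j _ hij => by
      simp only [hB, Set.disjoint_iUnion_left, Set.disjoint_iUnion_right]
      intro l hl l' hl'
      simp only [hs, Finset.mem_filter] at hl hl'
      refine hA.disjoint r _ l'.2 _ l.2 fun h => hij ?_
      rw [← hl'.2.1, ← hl.2.1, Fin.ext h])
    (fun i _ l hl => by
      by_cases h : (⟨l, hl⟩ : Fin (num r)) ∈ s i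
      · left
        exact Set.subset_biUnion_of_mem (u := fun l : Fin (num r) => A r l) h
      · right
        simp only [hB, Set.disjoint_iUnion_right]
        intro l' hl'
        refine hA.disjoint r _ hl _ l'.2 fun hh => h ?_
        have : (⟨l, hl⟩ : Fin (num r)) = l' := Fin.ext hh
        rwa [this])
  refine ⟨B j, ?_, ?_, ?_, hjK⟩
  · simp only [hB, Set.iUnion_subset_iff]
    intro l hl
    simp only [hs, Finset.mem_filter] at hl
    exact hl.2.2
  · exact Finset.measurableSet_biUnion _ fun l _ => hA.measurable r l
  · simpa [hJ] using hj

/-- The sums of squares over a sequence of families of cells with asymptotically small values are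
bounded in probability. -/
theorem sum_sq_bounded_in_probability [IsProbabilityMeasure P] (hm : IsExhaustive P m)
    (hA : IsCellSequence num A) (U : Ultrafilter ℕ)
    (hsmall : ∀ η > 0, Tendsto (fun n => P.real {ω | ∃ k < num n, η < |m (A n k) ω|}) U (𝓝 0))
    {d : ℝ} (hd : 0 < d) :
    ∃ K : ℝ, ∀ᶠ n in (U : Filter ℕ),
      P.real {ω | K < ∑ k ∈ Finset.range (num n), m (A n k) ω ^ 2} < d := by
  classical
  by_contra! hcon
  have h0 : ∀ K : ℝ, ∀ᶠ n in (U : Filter ℕ),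
      d ≤ P.real {ω | K < innerSquares m num A n Set.univ ω} := by
    intro K
    simpa [innerSquares] using hcon K
  -- The loss at stage `i` is `(d/2) 2^{-(i+1)}`, so the probability level never falls to `d/2`, and
  -- each set split off keeps the bound `(d/2)/128 = d/256`.
  set δ : ℕ → ℝ := fun i => d / 2 + d / 2 * (1 / 2) ^ i with hδ
  have hδpos : ∀ i, d / 2 < δ i := fun i => by
    have : 0 < d / 2 * (1 / 2 : ℝ) ^ i := by positivity
    simp only [hδ]; linarith
  -- The hypothesis on `R` sits under the existential so that `B` becomes a total function, usable
  -- in a recursion; `∅` is the default.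
  have step : ∀ (i : ℕ) (R : Set X), ∃ B : Set X, (∀ K : ℝ, ∀ᶠ n in (U : Filter ℕ),
      δ i ≤ P.real {ω | K < innerSquares m num A n R ω}) →
      B ⊆ R ∧ MeasurableSet B ∧ d / 256 ≤ P.real {ω | 1 ≤ |m B ω|} ∧
      ∀ K : ℝ, ∀ᶠ n in (U : Filter ℕ),
        δ (i + 1) ≤ P.real {ω | K < innerSquares m num A n (R \ B) ω} := by
    intro i R
    by_cases h : ∀ K : ℝ, ∀ᶠ n in (U : Filter ℕ),
      δ i ≤ P.real {ω | K < innerSquares m num A n R ω}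
    · obtain ⟨B, hB1, hB2, hB3, hB4⟩ := exists_split_off hm hA U hsmall R (e := d / 2 * (1 / 2) ^ (i + 1))
        (by linarith [hδpos i]) (by positivity) h
      refine ⟨B, fun _ => ⟨hB1, hB2, by linarith [hδpos i], ?_⟩⟩
      convert hB4 using 4
      simp only [hδ, pow_succ]
      ring
    · exact ⟨∅, fun h' => absurd h' h⟩
  choose B hB using step
  let R : ℕ → Set X := fun i => Nat.rec Set.univ (fun i R => R \ B i R) i
  have hRs : ∀ i, R (i + 1) = R i \ B i (R i) := fun _ => rfl
  have hR : ∀ i, ∀ K : ℝ, ∀ᶠ n in (U : Filter ℕ),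
      δ i ≤ P.real {ω | K < innerSquares m num A n (R i) ω} := by
    intro i
    induction i with
    | zero => simpa [hδ, R] using h0
    | succ i ih => exact (hB i (R i) ih).2.2.2
  have hanti : Antitone R := antitone_nat_of_succ_le fun i => by
    rw [hRs]; exact Set.sdiff_subset
  have hdis : ∀ i j, i < j → Disjoint (B i (R i)) (B j (R j)) := by
    intro i j hij
    have h1 : B j (R j) ⊆ R (i + 1) := (hB j (R j) (hR j)).1.trans (hanti hij)
    rw [hRs] at h1
    exact (Set.disjoint_sdiff_left.mono_left h1).symm
  have := hm.exhaustive (fun i => B i (R i)) (fun i => (hB i (R i) (hR i)).2.1)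
    (fun i j hij => by
      rcases lt_or_gt_of_ne hij with h | h
      · exact hdis i j h
      · exact (hdis j i h).symm)
  obtain ⟨i, hi⟩ := (this.eventually (gt_mem_nhds (show (0 : ℝ) < d / 256 by positivity))).exists
  exact absurd (hB i (R i) (hR i)).2.2.1 (not_le.2 hi)

end BoundedSquares

/-! ### Partitions of the interval and their half-open cells. -/

section Partitions

variable {T : ℝ}

lemma IntervalPartition.pt_mono (π : IntervalPartition T) {k l : ℕ} (hkl : k ≤ l)
    (hl : l ≤ π.num) : π.pt k ≤ π.pt l := by
  induction l, hkl using Nat.le_induction with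
  | base => exact le_rfl
  | succ l _ ih => exact (ih (by omega)).trans (π.pt_lt l (by omega)).le

lemma IntervalPartition.pt_mem (π : IntervalPartition T) {k : ℕ} (hk : k ≤ π.num) :
    π.pt k ∈ Set.Icc 0 T :=
  ⟨π.pt_zero.symm.trans_le (π.pt_mono (Nat.zero_le k) hk), (π.pt_mono hk le_rfl).trans_eq π.pt_num⟩

lemma IntervalPartition.sub_le_mesh (π : IntervalPartition T) {k : ℕ} (hk : k < π.num) :
    π.pt (k + 1) - π.pt k ≤ π.mesh :=
  le_ciSup (f := fun k : Fin π.num => π.pt (k + 1) - π.pt k) (Set.finite_range _).bddAbove ⟨k, hk⟩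

lemma IntervalPartition.exists_mem_Ico (π : IntervalPartition T) {t : ℝ} (h0 : 0 ≤ t) (hT : t < T) :
    ∃ j < π.num, π.pt j ≤ t ∧ t < π.pt (j + 1) := by
  have hex : ∃ j, j ≤ π.num ∧ t < π.pt j := ⟨π.num, le_rfl, by rw [π.pt_num]; exact hT⟩
  classical
  obtain ⟨h1, h2⟩ := Nat.find_spec hex
  obtain ⟨j, hj⟩ : ∃ j, Nat.find hex = j + 1 := by
    refine Nat.exists_eq_succ_of_ne_zero fun h => ?_
    rw [h, π.pt_zero] at h2
    linarith
  rw [hj] at h1 h2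
  refine ⟨j, by omega, ?_, h2⟩
  by_contra! h
  exact Nat.find_min hex (m := j) (by omega) ⟨by omega, h⟩

lemma exists_forall_sub_lt {x : ℝ → ℝ} (hx : ContinuousOn x (Set.Icc 0 T)) {η : ℝ} (hη : 0 < η) :
    ∃ δ > 0, ∀ s ∈ Set.Icc 0 T, ∀ t ∈ Set.Icc 0 T, |s - t| < δ → |x s - x t| < η := by
  have := Metric.uniformContinuousOn_iff.1 (isCompact_Icc.uniformContinuousOn_of_continuous hx) η hη
  simpa [Real.dist_eq] using this

lemma IntervalPartition.exists_increment_lt {x : ℝ → ℝ} (hx : ContinuousOn x (Set.Icc 0 T))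
    {η : ℝ} (hη : 0 < η) :
    ∃ δ > 0, ∀ π : IntervalPartition T, π.mesh < δ → ∀ k < π.num,
      |x (π.pt (k + 1)) - x (π.pt k)| < η := by
  obtain ⟨δ, hδ, h⟩ := exists_forall_sub_lt hx hη
  refine ⟨δ, hδ, fun π hπ k hk => h _ (π.pt_mem hk) _ (π.pt_mem hk.le) ?_⟩
  rw [abs_of_pos (sub_pos.2 (π.pt_lt k hk))]
  exact (π.sub_le_mesh hk).trans_lt hπ

/-- The `k`-th interval of a partition. -/
def IntervalPartition.cell (π : IntervalPartition T) (k : ℕ) : Set (Set.Icc (0 : ℝ) T) :=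
  {x | π.pt k < (x : ℝ) ∧ (x : ℝ) ≤ π.pt (k + 1)}

/-- For `cut`: an interval of the `n`-th partition not contained in one of the `r`-th has a point of
the latter strictly inside. Different intervals contain different points, so there are at most `(π
r).num + 1` of them, uniformly in `n`. -/
lemma IntervalPartition.isCellSequence (π : ℕ → IntervalPartition T) :
    IsCellSequence (fun n => (π n).num) (fun n k => (π n).cell k) where
  measurable n k := (measurableSet_lt measurable_const measurable_subtype_coe).inter
    (measurableSet_le measurable_subtype_coe measurable_const)
  disjoint n k hk l hl hkl := by
    have key : ∀ k l, l < (π n).num → k < l → Disjoint ((π n).cell k) ((π n).cell l) := by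
      intro k l hl hkl
      rw [Set.disjoint_left]
      rintro x ⟨-, h1⟩ ⟨h2, -⟩
      have := (π n).pt_mono (Nat.succ_le_of_lt hkl) hl.le
      exact absurd (h1.trans this) (not_le.2 h2)
    rcases lt_or_gt_of_ne hkl with h | h
    · exact key k l hl h
    · exact (key l k hk h).symm
  cut r := by
    refine ⟨(π r).num + 1, fun n s hs hcut => ?_⟩
    have hex : ∀ k, ∃ i, k ∈ s → i ∈ Finset.range ((π r).num + 1) ∧
        (π n).pt k < (π r).pt i ∧ (π r).pt i < (π n).pt (k + 1) := by
      intro k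
      by_cases hk : k ∈ s
      · have hkn := hs k hk
        obtain ⟨j, hj, h1, h2⟩ := (π r).exists_mem_Ico ((π n).pt_mem hkn.le).1
          (((π n).pt_lt k hkn).trans_le ((π n).pt_mem hkn).2)
        refine ⟨j + 1, fun _ => ⟨by simpa using hj, h2, ?_⟩⟩
        by_contra! h
        exact hcut k hk j hj fun x hx => ⟨h1.trans_lt hx.1, hx.2.trans h⟩
      · exact ⟨0, fun h => absurd h hk⟩
    choose i hi using hex
    rw [← Finset.card_range ((π r).num + 1)]
    refine Finset.card_le_card_of_injOn i (fun k hk => (hi k hk).1) ?_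
    have key : ∀ k ∈ s, ∀ l ∈ s, k < l → i k ≠ i l := by
      intro k hk l hl hkl h
      have h1 := (hi k hk).2.2
      have h2 := (hi l hl).2.1
      have h3 := (π n).pt_mono (Nat.succ_le_of_lt hkl) (hs l hl).le
      rw [h] at h1
      simp only [Nat.succ_eq_add_one] at h3
      linarith
    intro k hk l hl h
    by_contra hne
    rcases lt_or_gt_of_ne hne with h' | h'
    · exact key k hk l hl h' h
    · exact key l hl k hk h' h.symm

end Partitions

/-! ### Stochastic measures are exhaustive; squared increments are bounded in probability. -/

section QuadraticVariation

variable {Ω : Type*} [MeasurableSpace Ω] {P : Measure Ω}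

lemma tendsto_measureReal_zero_of_ae_eventually_notMem [IsProbabilityMeasure P] {Z : ℕ → Set Ω}
    (hZ : ∀ n, NullMeasurableSet (Z n) P) (h : ∀ᵐ ω ∂P, ∀ᶠ n in atTop, ω ∉ Z n) :
    Tendsto (fun n => P.real (Z n)) atTop (𝓝 0) := by
  have h1 : Tendsto (fun n => ∫ ω, (Z n).indicator (fun _ => (1 : ℝ)) ω ∂P) atTop
      (𝓝 (∫ _, (0 : ℝ) ∂P)) := by
    refine tendsto_integral_of_dominated_convergence (fun _ => 1)
      (fun n => aestronglyMeasurable_const.indicator₀ (hZ n)) (integrable_const 1) ?_ ?_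
    · intro n
      refine ae_of_all _ fun ω => ?_
      by_cases hω : ω ∈ Z n <;> simp [hω]
    · filter_upwards [h] with ω hω
      refine tendsto_const_nhds.congr' ?_
      filter_upwards [hω] with n hn
      simp [hn]
  have h2 : ∀ n, ∫ ω, (Z n).indicator (fun _ => (1 : ℝ)) ω ∂P = P.real (Z n) := fun n => by
    rw [integral_indicator₀ (hZ n)]; simp
  simpa [h2] using h1

variable {X : Type*} [MeasurableSpace X]

/-- The value on `A n` is the difference of two consecutive partial sums, which converge in
probability to the same limit. -/
lemma StochasticMeasure.tendsto_measureReal [IsProbabilityMeasure P] (μ : StochasticMeasure X P)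
    (A : ℕ → Set X) (hA : ∀ i, MeasurableSet (A i)) (hd : ∀ i j, i ≠ j → Disjoint (A i) (A j))
    {ε : ℝ} (hε : 0 < ε) :
    Tendsto (fun n => P.real {ω | ε ≤ |μ.toFun (A n) ω|}) atTop (𝓝 0) := by
  have h := tendstoInMeasure_iff_measureReal_norm.1 (μ.tendsto_iUnion A hA hd) (ε / 2) (half_pos hε)
  have h' := (h.comp (tendsto_add_atTop_nat 1)).add h
  rw [add_zero] at h'
  refine squeeze_zero (fun _ => measureReal_nonneg) (fun n => ?_) h'
  refine le_trans ?_ (measureReal_union_le _ _)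
  refine ENNReal.toReal_mono (measure_ne_top _ _) (measure_mono_ae ?_)
  have e : ((∑ i ∈ Finset.range (n + 1), μ.toFun (A i) : Ω →ₘ[P] ℝ) : Ω → ℝ) =ᵐ[P]
      fun ω => (∑ i ∈ Finset.range n, μ.toFun (A i) : Ω →ₘ[P] ℝ) ω + μ.toFun (A n) ω := by
    rw [Finset.sum_range_succ]
    exact AEEqFun.coeFn_add _ _
  filter_upwards [e] with ω hω hε'
  change ε ≤ |μ.toFun (A n) ω| at hε'
  change _ ∨ _
  change (ε / 2 ≤ ‖(∑ i ∈ Finset.range (n + 1), μ.toFun (A i) : Ω →ₘ[P] ℝ) ω - _‖) ∨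
    (ε / 2 ≤ ‖(∑ i ∈ Finset.range n, μ.toFun (A i) : Ω →ₘ[P] ℝ) ω - _‖)
  simp only [Real.norm_eq_abs]
  by_contra! hcon
  set s := (∑ i ∈ Finset.range n, μ.toFun (A i) : Ω →ₘ[P] ℝ) ω
  rw [hω] at hcon
  obtain ⟨h1, h2⟩ := hcon
  rw [abs_lt] at h1 h2
  have : |μ.toFun (A n) ω| < ε := abs_lt.2 ⟨by linarith [h1.1, h2.2], by linarith [h1.2, h2.1]⟩
  linarith

/-- The constant sequence `∅` is pairwise disjoint, so its constant value tends to `0` in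
probability. -/
lemma StochasticMeasure.empty [IsProbabilityMeasure P] (μ : StochasticMeasure X P) :
    μ.toFun ∅ = 0 := by
  refine AEEqFun.ext ?_
  refine EventuallyEq.trans ?_ AEEqFun.coeFn_zero.symm
  have h : ∀ j : ℕ, ∀ᵐ ω ∂P, |μ.toFun ∅ ω| < 1 / ((j : ℝ) + 1) := by
    intro j
    have := μ.tendsto_measureReal (fun _ => ∅) (fun _ => MeasurableSet.empty) (fun _ _ _ => by simp)
      (ε := 1 / ((j : ℝ) + 1)) (by positivity)
    have h0 := tendsto_nhds_unique tendsto_const_nhds this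
    rw [measureReal_eq_zero_iff] at h0
    rw [ae_iff]
    simpa using h0
  filter_upwards [ae_all_iff.2 h] with ω hω
  rw [Pi.zero_apply, ← abs_nonpos_iff]
  exact ge_of_tendsto tendsto_one_div_add_atTop_nhds_zero_nat (Eventually.of_forall fun j => (hω j).le)

/-- σ-additivity applied to `A, B, ∅, ∅, …`, whose partial sums are constant from the second on. -/
lemma StochasticMeasure.union [IsProbabilityMeasure P] (μ : StochasticMeasure X P) {A B : Set X}
    (hA : MeasurableSet A) (hB : MeasurableSet B) (hAB : Disjoint A B) :
    μ.toFun (A ∪ B) = μ.toFun A + μ.toFun B := by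
  set C : ℕ → Set X := fun i => if i = 0 then A else if i = 1 then B else ∅ with hC
  have h := μ.tendsto_iUnion C
    (fun i => by simp only [hC]; split_ifs <;> simp [hA, hB])
    (fun i j hij => by
      simp only [hC]
      split_ifs <;> first | omega | exact hAB | simp [hAB.symm])
  have hU : ⋃ i, C i = A ∪ B := by
    ext x
    simp only [Set.mem_iUnion, Set.mem_union, hC]
    constructor
    · rintro ⟨i, hi⟩
      split_ifs at hi <;> simp_all
    · rintro (h | h)
      · exact ⟨0, by simpa⟩
      · exact ⟨1, by simpa⟩
  have hs : ∀ n, ∑ i ∈ Finset.range (n + 2), μ.toFun (C i) = μ.toFun A + μ.toFun B := by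
    intro n
    induction n with
    | zero => simp [hC, Finset.sum_range_succ]
    | succ n ih =>
      rw [Finset.sum_range_succ, ih]
      simp [hC, μ.empty]
  rw [hU] at h
  have h' := h.comp (tendsto_add_atTop_nat 2)
  refine AEEqFun.ext (tendstoInMeasure_ae_unique h' ?_)
  intro ε hε
  simp only [Function.comp, hs, edist_self]
  simp [hε.not_ge]

lemma StochasticMeasure.isExhaustive [IsProbabilityMeasure P] (μ : StochasticMeasure X P) :
    IsExhaustive P (fun A ω => μ.toFun A ω) where
  measurable A := (AEEqFun.stronglyMeasurable _).measurable
  empty := by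
    rw [μ.empty]
    exact AEEqFun.coeFn_zero
  union A B hA hB hAB := by
    rw [μ.union hA hB hAB]
    exact AEEqFun.coeFn_add _ _
  exhaustive B hB hd := μ.tendsto_measureReal B hB hd one_pos

/-- The sums of squared increments of a continuous version of a stochastic measure, along
partitions with mesh tending to `0`, are bounded in probability. -/
theorem sum_sq_increments_bounded_in_probability [IsProbabilityMeasure P] {T : ℝ}
    {μ : StochasticMeasure (Set.Icc (0 : ℝ) T) P} {M : ℝ → Ω → ℝ}
    (hM : IsContinuousPathProcess μ M) (π : ℕ → IntervalPartition T)
    (hπ : Tendsto (fun n => (π n).mesh) atTop (𝓝 0)) (U : Ultrafilter ℕ) (hU : (U : Filter ℕ) ≤ atTop)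
    {d : ℝ} (hd : 0 < d) :
    ∃ K : ℝ, ∀ᶠ n in (U : Filter ℕ), P.real {ω | K < ∑ k ∈ Finset.range (π n).num,
      (M ((π n).pt (k + 1)) ω - M ((π n).pt k) ω) ^ 2} < d := by
  have hcell := IntervalPartition.isCellSequence π
  have hinc : ∀ᵐ ω ∂P, ∀ n, ∀ k < (π n).num,
      μ.toFun ((π n).cell k) ω = M ((π n).pt (k + 1)) ω - M ((π n).pt k) ω := by
    refine ae_all_iff.2 fun n => ae_all_iff.2 fun k => ?_
    by_cases hk : k < (π n).num
    · have h1 := hM.1 _ ((π n).pt_mem hk)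
      have h2 := hM.1 _ ((π n).pt_mem hk.le)
      have hm : ∀ t : ℝ, MeasurableSet {x : Set.Icc (0 : ℝ) T | 0 < (x : ℝ) ∧ (x : ℝ) ≤ t} :=
        fun t => (measurableSet_lt measurable_const measurable_subtype_coe).inter
          (measurableSet_le measurable_subtype_coe measurable_const)
      have h3 := μ.isExhaustive.union {x | 0 < (x : ℝ) ∧ (x : ℝ) ≤ (π n).pt k} ((π n).cell k)
        (hm _) (hcell.measurable n k) (by
          rw [Set.disjoint_left]
          rintro x ⟨-, h⟩ ⟨h', -⟩
          exact absurd h (not_le.2 h'))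
      have h4 : {x : Set.Icc (0 : ℝ) T | 0 < (x : ℝ) ∧ (x : ℝ) ≤ (π n).pt k} ∪ (π n).cell k =
          {x : Set.Icc (0 : ℝ) T | 0 < (x : ℝ) ∧ (x : ℝ) ≤ (π n).pt (k + 1)} := by
        ext x
        have := ((π n).pt_mem hk.le).1
        have h5 := (π n).pt_lt k hk
        simp only [IntervalPartition.cell, Set.mem_union, Set.mem_ofPred_eq]
        constructor
        · rintro (⟨h, h'⟩ | ⟨h, h'⟩)
          · exact ⟨h, h'.trans h5.le⟩
          · exact ⟨this.trans_lt h, h'⟩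
        · rintro ⟨h, h'⟩
          rcases le_or_gt (x : ℝ) ((π n).pt k) with h6 | h6
          · exact Or.inl ⟨h, h6⟩
          · exact Or.inr ⟨h6, h'⟩
      rw [h4] at h3
      filter_upwards [h1, h2, h3] with ω h1 h2 h3 _
      rw [h1, h2, h3]
      ring
    · exact ae_of_all _ fun _ h => absurd h hk
  -- Path continuity enters here: the increments on a path are uniformly small once the mesh is.
  have hsmall : ∀ η > 0, Tendsto (fun n => P.real {ω | ∃ k < (π n).num,
      η < |μ.toFun ((π n).cell k) ω|}) atTop (𝓝 0) := by
    intro η hη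
    refine tendsto_measureReal_zero_of_ae_eventually_notMem (fun n => ?_) ?_
    · have : {ω | ∃ k < (π n).num, η < |μ.toFun ((π n).cell k) ω|} =
          ⋃ k ∈ Finset.range (π n).num, {ω | η < |μ.toFun ((π n).cell k) ω|} := by
        ext ω; simp
      rw [this]
      exact (Finset.measurableSet_biUnion _ fun k _ =>
        measurableSet_lt measurable_const (μ.isExhaustive.measurable _).abs).nullMeasurableSet
    · filter_upwards [hinc, hM.2] with ω h1 h2
      obtain ⟨δ, hδ, h⟩ := IntervalPartition.exists_increment_lt h2 hη
      filter_upwards [hπ.eventually (gt_mem_nhds hδ)] with n hn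
      rintro ⟨k, hk, hlt⟩
      rw [h1 n k hk] at hlt
      exact absurd hlt (not_lt.2 (h (π n) hn k hk).le)
  obtain ⟨K, hK⟩ := sum_sq_bounded_in_probability μ.isExhaustive hcell U
    (fun η hη => (hsmall η hη).mono_left hU) hd
  refine ⟨K, ?_⟩
  filter_upwards [hK] with n hn
  refine lt_of_eq_of_lt (measureReal_congr ?_) hn
  filter_upwards [hinc] with ω hω
  simp only [eq_iff_iff]
  change (K < _) ↔ (K < _)
  rw [Finset.sum_congr rfl fun k hk => by rw [← hω n k (Finset.mem_range.1 hk)]]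

end QuadraticVariation

/-! ### Existence of the Riemann–Stieltjes integral. -/

section Stieltjes

variable {T : ℝ}

/-- On each cell, the sum and the Lebesgue–Stieltjes integral differ by at most the oscillation of
`φ` times the mass of the cell. -/
lemma hasStieltjesIntegral_stieltjesFunction {φ : ℝ → ℝ} (hφ : ContinuousOn φ (Set.Icc 0 T))
    (F : StieltjesFunction ℝ) :
    HasStieltjesIntegral T φ F (∫ x in (0 : ℝ)..T, φ x ∂F.measure) := by
  intro ε hε
  set B := |F T - F 0| + 1 with hB
  have hBpos : 0 < B := by positivity
  obtain ⟨δ, hδ, h⟩ := exists_forall_sub_lt hφ (η := ε / B) (by positivity)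
  refine ⟨δ, hδ, fun π hπ c hc => ?_⟩
  have hint : ∀ k < π.num, IntervalIntegrable φ F.measure (π.pt k) (π.pt (k + 1)) := by
    intro k hk
    refine ContinuousOn.intervalIntegrable (hφ.mono ?_)
    rw [Set.uIcc_of_le (π.pt_lt k hk).le]
    exact Set.Icc_subset_Icc (π.pt_mem hk.le).1 (π.pt_mem hk).2
  have hsum := intervalIntegral.sum_integral_adjacent_intervals (n := π.num) (a := π.pt) hint
  rw [π.pt_zero, π.pt_num] at hsum
  rw [← hsum, ← Finset.sum_sub_distrib]
  have hterm : ∀ k < π.num, |φ (c k) * (F (π.pt (k + 1)) - F (π.pt k)) -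
      ∫ x in π.pt k..π.pt (k + 1), φ x ∂F.measure| ≤
      ε / B * (F (π.pt (k + 1)) - F (π.pt k)) := by
    intro k hk
    have hle := (π.pt_lt k hk).le
    have hF : 0 ≤ F (π.pt (k + 1)) - F (π.pt k) := sub_nonneg.2 (F.mono hle)
    have hreal : F.measure.real (Set.Ioc (π.pt k) (π.pt (k + 1))) =
        F (π.pt (k + 1)) - F (π.pt k) := by
      rw [measureReal_def, F.measure_Ioc, ENNReal.toReal_ofReal hF]
    have hfin : F.measure (Set.Ioc (π.pt k) (π.pt (k + 1))) < ⊤ := by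
      rw [F.measure_Ioc]; exact ENNReal.ofReal_lt_top
    have hconst : φ (c k) * (F (π.pt (k + 1)) - F (π.pt k)) =
        ∫ x in Set.Ioc (π.pt k) (π.pt (k + 1)), φ (c k) ∂F.measure := by
      rw [setIntegral_const, hreal, smul_eq_mul, mul_comm]
    rw [hconst, intervalIntegral.integral_of_le hle, ← integral_sub
      (f := fun _ => φ (c k)) (integrableOn_const hfin.ne (by simp)) ((intervalIntegrable_iff_integrableOn_Ioc_of_le hle).1 (hint k hk)),
      ← hreal, ← Real.norm_eq_abs]
    refine norm_setIntegral_le_of_norm_le_const hfin fun x hx => ?_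
    have hx' : x ∈ Set.Icc 0 T :=
      ⟨(π.pt_mem hk.le).1.trans hx.1.le, hx.2.trans (π.pt_mem hk).2⟩
    have hc' : c k ∈ Set.Icc 0 T :=
      ⟨(π.pt_mem hk.le).1.trans (hc k hk).1, (hc k hk).2.trans (π.pt_mem hk).2⟩
    refine (h _ hc' _ hx' ?_).le
    have h1 := π.sub_le_mesh hk
    rw [abs_lt]
    constructor <;> linarith [(hc k hk).1, (hc k hk).2, hx.1, hx.2]
  calc |∑ k ∈ Finset.range π.num, (φ (c k) * (F (π.pt (k + 1)) - F (π.pt k)) -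
        ∫ x in π.pt k..π.pt (k + 1), φ x ∂F.measure)|
      ≤ ∑ k ∈ Finset.range π.num, |φ (c k) * (F (π.pt (k + 1)) - F (π.pt k)) -
        ∫ x in π.pt k..π.pt (k + 1), φ x ∂F.measure| := Finset.abs_sum_le_sum_abs _ _
    _ ≤ ∑ k ∈ Finset.range π.num, ε / B * (F (π.pt (k + 1)) - F (π.pt k)) :=
        Finset.sum_le_sum fun k hk => hterm k (Finset.mem_range.1 hk)
    _ = ε / B * (F T - F 0) := by
        rw [← Finset.mul_sum, Finset.sum_range_sub (fun k => F (π.pt k)), π.pt_zero, π.pt_num]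
    _ ≤ ε / B * |F T - F 0| := by gcongr; exact le_abs_self _
    _ < ε / B * B := by gcongr; simp [hB]
    _ = ε := by field_simp

lemma HasStieltjesIntegral.sub {φ u v : ℝ → ℝ} {S R : ℝ} (hu : HasStieltjesIntegral T φ u S)
    (hv : HasStieltjesIntegral T φ v R) :
    HasStieltjesIntegral T φ (fun t => u t - v t) (S - R) := by
  intro ε hε
  obtain ⟨δ₁, h₁, H₁⟩ := hu (ε / 2) (half_pos hε)
  obtain ⟨δ₂, h₂, H₂⟩ := hv (ε / 2) (half_pos hε)
  refine ⟨min δ₁ δ₂, lt_min h₁ h₂, fun π hπ c hc => ?_⟩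
  have a := H₁ π (hπ.trans_le (min_le_left _ _)) c hc
  have b := H₂ π (hπ.trans_le (min_le_right _ _)) c hc
  have e : ∑ k ∈ Finset.range π.num, φ (c k) *
      ((u (π.pt (k + 1)) - v (π.pt (k + 1))) - (u (π.pt k) - v (π.pt k))) =
      ∑ k ∈ Finset.range π.num, φ (c k) * (u (π.pt (k + 1)) - u (π.pt k)) -
      ∑ k ∈ Finset.range π.num, φ (c k) * (v (π.pt (k + 1)) - v (π.pt k)) := by
    rw [← Finset.sum_sub_distrib]
    exact Finset.sum_congr rfl fun k _ => by ring
  rw [e]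
  rw [abs_lt] at a b ⊢
  constructor <;> linarith [a.1, a.2, b.1, b.2]

lemma HasStieltjesIntegral.congr_integrator {φ u v : ℝ → ℝ} {S : ℝ}
    (hu : HasStieltjesIntegral T φ u S) (h : ∀ t ∈ Set.Icc 0 T, u t = v t) :
    HasStieltjesIntegral T φ v S := by
  intro ε hε
  obtain ⟨δ, hδ, H⟩ := hu ε hε
  refine ⟨δ, hδ, fun π hπ c hc => ?_⟩
  rw [Finset.sum_congr rfl fun k hk => by
    rw [← h _ (π.pt_mem (Finset.mem_range.1 hk)), ← h _ (π.pt_mem (Finset.mem_range.1 hk).le)]]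
  exact H π hπ c hc

/-- A continuous function is Riemann–Stieltjes integrable with respect to a continuous function of
bounded variation. -/
theorem exists_hasStieltjesIntegral (hT : 0 < T) {φ v : ℝ → ℝ}
    (hφ : ContinuousOn φ (Set.Icc 0 T)) (hv : ContinuousOn v (Set.Icc 0 T))
    (hbv : BoundedVariationOn v (Set.Icc 0 T)) : ∃ S, HasStieltjesIntegral T φ v S := by
  obtain ⟨p, q, hp, hq, hpq⟩ := hbv.locallyBoundedVariationOn.exists_monotoneOn_sub_monotoneOn
  have hmono : ∀ {p : ℝ → ℝ}, MonotoneOn p (Set.Icc 0 T) →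
      Monotone (fun t => p (Set.projIcc 0 T hT.le t)) := fun hp s t hst =>
    hp (Subtype.coe_prop _) (Subtype.coe_prop _) (Set.monotone_projIcc hT.le hst)
  have hP := hmono hp
  have hQ := hmono hq
  refine ⟨_, ((hasStieltjesIntegral_stieltjesFunction hφ hP.stieltjesFunction).sub
    (hasStieltjesIntegral_stieltjesFunction hφ hQ.stieltjesFunction)).congr_integrator ?_⟩
  intro t ht
  rw [hP.stieltjesFunction_eq, hQ.stieltjesFunction_eq]
  have hcont : Continuous (fun t => v (Set.projIcc 0 T hT.le t)) :=
    (continuousOn_iff_continuous_domRestrict.1 hv).comp continuous_projIcc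
  -- The Stieltjes functions use right limits of the Jordan components, which are not known to be
  -- right-continuous. Their difference is still `v`, because `v` is continuous.
  have h1 : Tendsto (fun t => v (Set.projIcc 0 T hT.le t)) (𝓝[>] t) (𝓝 (v t)) := by
    have := (hcont.tendsto t).mono_left (nhdsWithin_le_nhds (s := Set.Ioi t))
    rwa [Set.projIcc_of_mem hT.le ht] at this
  have h2 := (hP.tendsto_rightLim t).sub (hQ.tendsto_rightLim t)
  refine tendsto_nhds_unique h2 (h1.congr fun s => ?_)
  rw [hpq]
  rfl

end Stieltjes

/-! ### Trapezoidal expansions with error `o((Δx)² + |Δv|)`. -/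

section SmallDefects

lemma IsC11.hasDerivAt1 {f : ℝ → ℝ → ℝ} (hf : IsC11 f) (x v : ℝ) :
    HasDerivAt (fun y => f y v) (partial1 f x v) x := (hf.differentiable1 v x).hasDerivAt

lemma IsC11.hasDerivAt2 {f : ℝ → ℝ → ℝ} (hf : IsC11 f) (x v : ℝ) :
    HasDerivAt (fun w => f x w) (partial2 f x v) v := (hf.differentiable2 x v).hasDerivAt

lemma IsC21.hasDerivAt11 {g : ℝ → ℝ → ℝ} (hg : IsC21 g) (x v : ℝ) :
    HasDerivAt (fun y => partial1 g y v) (partial1 (partial1 g) x v) x :=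
  (hg.differentiable11 v x).hasDerivAt

/-- Mean value inequality on the segment between two reals. -/
lemma abs_sub_le_of_hasDerivAt {φ φ' : ℝ → ℝ} (h : ∀ t, HasDerivAt φ (φ' t) t) {x y C : ℝ}
    (hC : ∀ t ∈ Set.uIcc x y, |φ' t| ≤ C) : |φ y - φ x| ≤ C * |y - x| := by
  simpa using (convex_uIcc x y).norm_image_sub_le_of_norm_hasDerivWithin_le
    (fun t _ => (h t).hasDerivWithinAt) hC Set.left_mem_uIcc Set.right_mem_uIcc

lemma abs_taylor_le {φ φ' φ'' : ℝ → ℝ} (h : ∀ t, HasDerivAt φ (φ' t) t)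
    (h' : ∀ t, HasDerivAt φ' (φ'' t) t) {x y C : ℝ} (hC0 : 0 ≤ C)
    (hC : ∀ t ∈ Set.uIcc x y, |φ'' t| ≤ C) : |φ y - φ x - φ' x * (y - x)| ≤ C * (y - x) ^ 2 := by
  have h1 : ∀ t ∈ Set.uIcc x y, |φ' t - φ' x| ≤ C * |y - x| := fun t ht =>
    (abs_sub_le_of_hasDerivAt h' fun s hs => hC s (Set.uIcc_subset_uIcc_left ht hs)).trans
      (mul_le_mul_of_nonneg_left (Set.abs_sub_left_of_mem_uIcc ht) hC0)
  have h2 := abs_sub_le_of_hasDerivAt (φ := fun t => φ t - φ' x * t) (φ' := fun t => φ' t - φ' x)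
    (fun t => ((h t).sub ((hasDerivAt_id t).const_mul (φ' x))).congr_deriv (by simp)) h1
  calc |φ y - φ x - φ' x * (y - x)| = |φ y - φ' x * y - (φ x - φ' x * x)| := by congr 1; ring
    _ ≤ C * |y - x| * |y - x| := h2
    _ = C * (y - x) ^ 2 := by rw [mul_assoc, abs_mul_abs_self]; ring

lemma abs_le_of_mem_uIcc {x y t R : ℝ} (hx : |x| ≤ R) (hy : |y| ≤ R) (ht : t ∈ Set.uIcc x y) :
    |t| ≤ R := by
  have : t ∈ Set.Icc (-R) R :=
    Set.uIcc_subset_Icc (abs_le.1 hx) (abs_le.1 hy) ht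
  exact abs_le.2 this

lemma exists_bound_of_continuous {G : ℝ → ℝ → ℝ} (hG : Continuous fun p : ℝ × ℝ => G p.1 p.2)
    (R : ℝ) : ∃ B > 0, ∀ x v, |x| ≤ R → |v| ≤ R → |G x v| ≤ B := by
  obtain ⟨B, hB⟩ := ((isCompact_Icc (a := -R) (b := R)).prod
    (isCompact_Icc (a := -R) (b := R))).exists_bound_of_continuousOn hG.continuousOn
  exact ⟨max B 1, by positivity, fun x v hx hv =>
    (hB (x, v) ⟨abs_le.1 hx, abs_le.1 hv⟩).trans (le_max_left _ _)⟩

lemma exists_modulus_of_continuous {G : ℝ → ℝ → ℝ} (hG : Continuous fun p : ℝ × ℝ => G p.1 p.2)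
    (R : ℝ) {ε : ℝ} (hε : 0 < ε) : ∃ δ > 0, ∀ x v y w, |x| ≤ R → |v| ≤ R → |y| ≤ R → |w| ≤ R →
      |y - x| < δ → |w - v| < δ → |G y w - G x v| ≤ ε := by
  have := Metric.uniformContinuousOn_iff.1 (((isCompact_Icc (a := -R) (b := R)).prod
    (isCompact_Icc (a := -R) (b := R))).uniformContinuousOn_of_continuous hG.continuousOn) ε hε
  obtain ⟨δ, hδ, h⟩ := this
  refine ⟨δ, hδ, fun x v y w hx hv hy hw h1 h2 => ?_⟩
  have := h (y, w) ⟨abs_le.1 hy, abs_le.1 hw⟩ (x, v) ⟨abs_le.1 hx, abs_le.1 hv⟩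
    (by rw [Prod.dist_eq]; exact max_lt h1 h2)
  exact le_of_lt this

/-- `E(x,v,y,w) = o((y-x)² + |w-v|)`, uniformly on compact sets. -/
def IsSmallDefect (E : ℝ → ℝ → ℝ → ℝ → ℝ) : Prop :=
  ∀ R : ℝ, ∀ ε > 0, ∃ δ > 0, ∀ x v y w, |x| ≤ R → |v| ≤ R → |y| ≤ R → |w| ≤ R →
    |y - x| < δ → |w - v| < δ → |E x v y w| ≤ ε * ((y - x) ^ 2 + |w - v|)

/-- The trapezoidal rule for the increments of a function of class `C^{2,1}`. -/
theorem IsC21.isSmallDefect {g : ℝ → ℝ → ℝ} (hg : IsC21 g) :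
    IsSmallDefect fun x v y w => g y w - g x v -
      ((partial1 g x v + partial1 g y w) / 2 * (y - x) + partial2 g x v * (w - v)) := by
  intro R ε hε
  set η := ε / 4 with hη
  have hη0 : 0 < η := by positivity
  obtain ⟨δ₁, hδ₁, H₁⟩ := exists_modulus_of_continuous hg.continuous_partial11 R hη0
  obtain ⟨δ₂, hδ₂, H₂⟩ := exists_modulus_of_continuous hg.continuous_partial2 R hη0
  refine ⟨min δ₁ δ₂, lt_min hδ₁ hδ₂, fun x v y w hx hv hy hw h1 h2 => ?_⟩
  have h11 := h1.trans_le (min_le_left _ _)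
  have h12 := h1.trans_le (min_le_right _ _)
  have h21 := h2.trans_le (min_le_left _ _)
  have h22 := h2.trans_le (min_le_right _ _)
  -- The trapezoidal rule is exact on quadratics. Subtracting `c/2 · (t - x)²` leaves a function
  -- whose second derivative is at most `η` on the segment.
  have T1 : |g y w - g x w - (partial1 g x w + partial1 g y w) / 2 * (y - x)| ≤
      3 / 2 * η * (y - x) ^ 2 := by
    set c := partial1 (partial1 g) x w with hc
    have hC : ∀ t ∈ Set.uIcc x y, |partial1 (partial1 g) t w - c| ≤ η := fun t ht =>
      H₁ x w t w hx hw (abs_le_of_mem_uIcc hx hy ht) hw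
        ((Set.abs_sub_left_of_mem_uIcc ht).trans_lt h11) (by simpa using hδ₁)
    have hd1 : ∀ t, HasDerivAt (fun t => g t w - c / 2 * (t - x) ^ 2)
        (partial1 g t w - c * (t - x)) t := fun t => by
      have := (hg.hasDerivAt1 t w).sub ((((hasDerivAt_id t).sub_const x).pow 2).const_mul (c / 2))
      refine this.congr_deriv ?_
      simp
      ring
    have hd2 : ∀ t, HasDerivAt (fun t => partial1 g t w - c * (t - x))
        (partial1 (partial1 g) t w - c) t := fun t => by
      have := (hg.hasDerivAt11 t w).sub (((hasDerivAt_id t).sub_const x).const_mul c)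
      refine this.congr_deriv ?_
      simp
    have a1 := abs_taylor_le hd1 hd2 hη0.le hC
    have a2 := abs_sub_le_of_hasDerivAt hd2 hC
    have a3 : |((partial1 g y w - c * (y - x)) - (partial1 g x w - c * (x - x))) * (y - x) / 2| ≤
        1 / 2 * η * (y - x) ^ 2 := by
      rw [abs_div, abs_mul, abs_two]
      have : |partial1 g y w - c * (y - x) - (partial1 g x w - c * (x - x))| * |y - x| ≤
          η * |y - x| * |y - x| := by gcongr
      rw [mul_assoc, abs_mul_abs_self] at this
      linarith
    calc _ = |(g y w - c / 2 * (y - x) ^ 2 - (g x w - c / 2 * (x - x) ^ 2) -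
          (partial1 g x w - c * (x - x)) * (y - x)) -
          ((partial1 g y w - c * (y - x)) - (partial1 g x w - c * (x - x))) * (y - x) / 2| := by
            congr 1; ring
      _ ≤ _ := (abs_sub _ _).trans (by linarith)
  -- This replaces a mixed derivative. The second difference of `g` over the rectangle is estimated
  -- twice: by Taylor expansion in the first variable, with error `η (y-x)²`, and by the mean value
  -- theorem in the second, with bound `η |w-v|`.
  have T2 : |(partial1 g x w - partial1 g x v) * (y - x)| ≤
      η * (y - x) ^ 2 + η * |w - v| := by
    have a1 := abs_taylor_le (φ := fun t => g t w - g t v)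
      (φ' := fun t => partial1 g t w - partial1 g t v)
      (φ'' := fun t => partial1 (partial1 g) t w - partial1 (partial1 g) t v)
      (fun t => (hg.hasDerivAt1 t w).sub (hg.hasDerivAt1 t v))
      (fun t => (hg.hasDerivAt11 t w).sub (hg.hasDerivAt11 t v)) (x := x) (y := y) hη0.le
      (fun t ht => by
        have := abs_le_of_mem_uIcc hx hy ht
        exact H₁ t v t w this hv this hw (by simpa using hδ₁) h21)
    have a2 := abs_sub_le_of_hasDerivAt (φ := fun u => g y u - g x u)
      (φ' := fun u => partial2 g y u - partial2 g x u)
      (fun u => (hg.hasDerivAt2 y u).sub (hg.hasDerivAt2 x u)) (x := v) (y := w) (C := η)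
      (fun u hu => by
        have := abs_le_of_mem_uIcc hv hw hu
        exact H₂ x u y u hx this hy this h12 (by simpa using hδ₂))
    calc _ = |(g y w - g x w - (g y v - g x v)) - (g y w - g y v - (g x w - g x v) -
          (partial1 g x w - partial1 g x v) * (y - x))| := by congr 1; ring
      _ ≤ _ := (abs_sub _ _).trans (by linarith)
  have T3 : |g x w - g x v - partial2 g x v * (w - v)| ≤ η * |w - v| := by
    have a2 := abs_sub_le_of_hasDerivAt (φ := fun u => g x u - partial2 g x v * u)
      (φ' := fun u => partial2 g x u - partial2 g x v)
      (fun u => ((hg.hasDerivAt2 x u).sub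
        ((hasDerivAt_id u).const_mul (partial2 g x v))).congr_deriv (by simp))
      (x := v) (y := w) (C := η)
      (fun u hu => H₂ x v x u hx hv hx (abs_le_of_mem_uIcc hv hw hu) (by simpa using hδ₂)
        ((Set.abs_sub_left_of_mem_uIcc hu).trans_lt h22))
    calc _ = |g x w - partial2 g x v * w - (g x v - partial2 g x v * v)| := by congr 1; ring
      _ ≤ _ := a2
  calc _ = |(g y w - g x w - (partial1 g x w + partial1 g y w) / 2 * (y - x)) +
        (partial1 g x w - partial1 g x v) * (y - x) / 2 +
        (g x w - g x v - partial2 g x v * (w - v))| := by congr 1; ring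
    _ ≤ |g y w - g x w - (partial1 g x w + partial1 g y w) / 2 * (y - x)| +
        |(partial1 g x w - partial1 g x v) * (y - x)| / 2 +
        |g x w - g x v - partial2 g x v * (w - v)| := by
      refine (abs_add_le _ _).trans ?_
      gcongr
      refine (abs_add_le _ _).trans ?_
      rw [abs_div, abs_two]
    _ ≤ 3 / 2 * η * (y - x) ^ 2 + (η * (y - x) ^ 2 + η * |w - v|) / 2 + η * |w - v| := by gcongr
    _ ≤ _ := by
      have : 0 ≤ η * (y - x) ^ 2 := by positivity
      have : 0 ≤ η * |w - v| := by positivity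
      rw [show ε = 4 * η by rw [hη]; ring]
      linarith

/-- The symmetric product `f ∘ dg` decomposes into the symmetric product `(f g₁') ∘ dx` and the
product `f g₂' dv`, up to a small defect. -/
theorem IsC21.isSmallDefect_mul {f g : ℝ → ℝ → ℝ} (hf : IsC11 f) (hg : IsC21 g) :
    IsSmallDefect fun x v y w => (f x v + f y w) / 2 * (g y w - g x v) -
      ((f x v * partial1 g x v + f y w * partial1 g y w) / 2 * (y - x) +
        f x v * partial2 g x v * (w - v)) := by
  intro R ε hε
  obtain ⟨Bf, hBf, hf0⟩ := exists_bound_of_continuous hf.continuous R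
  obtain ⟨B1, hB1, hf1⟩ := exists_bound_of_continuous hf.continuous_partial1 R
  obtain ⟨B2, hB2, hf2⟩ := exists_bound_of_continuous hf.continuous_partial2 R
  obtain ⟨Bg, hBg, hg2⟩ := exists_bound_of_continuous hg.continuous_partial2 R
  obtain ⟨δ₁, hδ₁, H₁⟩ := hg.isSmallDefect R (ε / (3 * Bf)) (by positivity)
  obtain ⟨δ₂, hδ₂, H₂⟩ := exists_modulus_of_continuous hg.continuous_partial1 R
    (ε := ε / (B1 + B2)) (by positivity)
  obtain ⟨δ₃, hδ₃, H₃⟩ := exists_modulus_of_continuous hf.continuous R (ε := ε / (3 * Bg))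
    (by positivity)
  refine ⟨min (min δ₁ δ₂) (min δ₃ 1), by positivity, fun x v y w hx hv hy hw h1 h2 => ?_⟩
  simp only [lt_min_iff] at h1 h2
  obtain ⟨⟨h11, h12⟩, h13, h14⟩ := h1
  obtain ⟨⟨h21, h22⟩, h23, -⟩ := h2
  set D := (y - x) ^ 2 + |w - v| with hD
  have hD0 : 0 ≤ D := by positivity
  have E1 := H₁ x v y w hx hv hy hw h11 h21
  have E2 := H₂ x v y w hx hv hy hw h12 h22
  have E3 := H₃ x v y w hx hv hy hw h13 h23
  have Lf : |f y w - f x v| ≤ B1 * |y - x| + B2 * |w - v| := by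
    have a1 := abs_sub_le_of_hasDerivAt (fun t => hf.hasDerivAt1 t w) (x := x) (y := y)
      fun t ht => hf1 t w (abs_le_of_mem_uIcc hx hy ht) hw
    have a2 := abs_sub_le_of_hasDerivAt (fun u => hf.hasDerivAt2 x u) (x := v) (y := w)
      fun u hu => hf2 x u hx (abs_le_of_mem_uIcc hv hw hu)
    calc |f y w - f x v| = |(f y w - f x w) + (f x w - f x v)| := by congr 1; ring
      _ ≤ _ := (abs_add_le _ _).trans (add_le_add a1 a2)
  have P1 : |(f x v + f y w) / 2 * (g y w - g x v -
      ((partial1 g x v + partial1 g y w) / 2 * (y - x) + partial2 g x v * (w - v)))| ≤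
      ε / 3 * D := by
    have hb : |(f x v + f y w) / 2| ≤ Bf := by
      rw [abs_div, abs_two]
      linarith [abs_add_le (f x v) (f y w), hf0 x v hx hv, hf0 y w hy hw]
    rw [abs_mul]
    calc _ ≤ Bf * (ε / (3 * Bf) * D) := by gcongr
      _ = _ := by field_simp
  have P2 : |(f y w - f x v) * (partial1 g y w - partial1 g x v) * (y - x)| ≤ ε * D := by
    rw [abs_mul, abs_mul]
    -- The restriction `|y - x| < 1` absorbs the mixed product `|w - v| |y - x|` into `|w - v|`.
    have hL : (B1 * |y - x| + B2 * |w - v|) * |y - x| ≤ (B1 + B2) * D := by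
      have e1 : |y - x| * |y - x| = (y - x) ^ 2 := by rw [abs_mul_abs_self]; ring
      have e2 : |w - v| * |y - x| ≤ |w - v| := mul_le_of_le_one_right (abs_nonneg _) h14.le
      have e3 : B2 * (|w - v| * |y - x|) ≤ B2 * |w - v| := by gcongr
      have e4 : 0 ≤ B1 * |w - v| := by positivity
      have e5 : 0 ≤ B2 * (y - x) ^ 2 := by positivity
      calc _ = B1 * (|y - x| * |y - x|) + B2 * (|w - v| * |y - x|) := by ring
        _ ≤ _ := by rw [e1, hD]; linarith
    calc _ ≤ (B1 * |y - x| + B2 * |w - v|) * (ε / (B1 + B2)) * |y - x| := by gcongr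
      _ = (B1 * |y - x| + B2 * |w - v|) * |y - x| * (ε / (B1 + B2)) := by ring
      _ ≤ (B1 + B2) * D * (ε / (B1 + B2)) := by gcongr
      _ = _ := by field_simp
  have P3 : |(f y w - f x v) * partial2 g x v * (w - v)| ≤ ε / 3 * D := by
    rw [abs_mul, abs_mul]
    have hw' : |w - v| ≤ D := by rw [hD]; linarith [sq_nonneg (y - x)]
    calc _ ≤ ε / (3 * Bg) * Bg * D := by
          gcongr
          exact hg2 x v hx hv
      _ = _ := by field_simp
  -- Product of averages against average of products: `(a+b)(c+d)/4 - (ac+bd)/2 = -(b-a)(d-c)/4`.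
  calc _ = |(f x v + f y w) / 2 * (g y w - g x v -
        ((partial1 g x v + partial1 g y w) / 2 * (y - x) + partial2 g x v * (w - v))) -
        (f y w - f x v) * (partial1 g y w - partial1 g x v) * (y - x) / 4 +
        (f y w - f x v) * partial2 g x v * (w - v) / 2| := by congr 1; ring
    _ ≤ ε / 3 * D + ε * D / 4 + ε / 3 * D / 2 := by
      refine (abs_add_le _ _).trans (add_le_add ((abs_sub _ _).trans (add_le_add P1 ?_)) ?_)
      · rw [abs_div, abs_of_pos (by norm_num : (0 : ℝ) < 4)]; gcongr
      · rw [abs_div, abs_two]; gcongr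
    _ ≤ ε * D := by nlinarith [mul_nonneg hε.le hD0]

end SmallDefects

/-! ### The primitive of `f g₁'` in the first variable is of class `C^{2,1}`. -/

section Antiderivative

/-- The divided difference of `f` in the second variable. -/
noncomputable def dividedDiff2 (f : ℝ → ℝ → ℝ) (x v w : ℝ) : ℝ :=
  ∫ s in (0 : ℝ)..1, partial2 f x (v + s * (w - v))

lemma IsC11.dividedDiff2_mul {f : ℝ → ℝ → ℝ} (hf : IsC11 f) (x v w : ℝ) :
    f x w - f x v = (w - v) * dividedDiff2 f x v w := by
  have hc : Continuous fun s : ℝ => partial2 f x (v + s * (w - v)) :=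
    hf.continuous_partial2.comp (f := fun s : ℝ => (x, v + s * (w - v))) (by fun_prop)
  have h := intervalIntegral.integral_eq_sub_of_hasDerivAt (a := (0 : ℝ)) (b := 1)
    (f := fun s => f x (v + s * (w - v))) (f' := fun s => partial2 f x (v + s * (w - v)) * (w - v))
    (fun s _ => (hf.hasDerivAt2 x (v + s * (w - v))).comp s
      (((hasDerivAt_id s).mul_const (w - v)).const_add v |>.congr_deriv (by simp)))
    ((hc.mul continuous_const).intervalIntegrable _ _)
  rw [intervalIntegral.integral_mul_const] at h
  simp only [one_mul, zero_mul, add_zero, add_sub_cancel] at h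
  rw [← h, dividedDiff2]
  ring

lemma dividedDiff2_self (f : ℝ → ℝ → ℝ) (x v : ℝ) :
    dividedDiff2 f x v v = partial2 f x v := by
  simp [dividedDiff2]

lemma IsC11.continuous_dividedDiff2 {f : ℝ → ℝ → ℝ} (hf : IsC11 f) (v : ℝ) :
    Continuous fun p : ℝ × ℝ => dividedDiff2 f p.1 v p.2 := by
  unfold dividedDiff2
  refine intervalIntegral.continuous_parametric_intervalIntegral_of_continuous'
    (f := fun (p : ℝ × ℝ) s => partial2 f p.1 (v + s * (p.2 - v))) ?_ 0 1
  exact hf.continuous_partial2.comp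
    (f := fun q : (ℝ × ℝ) × ℝ => (q.1.1, v + q.2 * (q.1.2 - v))) (by fun_prop)

/-- The antiderivative `∫₀ˣ f(y,v) g₁'(y,v) dy`. -/
noncomputable def mulPartialPrimitive (f g : ℝ → ℝ → ℝ) (x v : ℝ) : ℝ :=
  ∫ y in (0 : ℝ)..x, f y v * partial1 g y v

/-- The derivative of `mulPartialPrimitive f g` in the second variable, in a form free of mixed
derivatives. -/
noncomputable def mulPartialPrimitive2 (f g : ℝ → ℝ → ℝ) (x v : ℝ) : ℝ :=
  (∫ y in (0 : ℝ)..x, partial2 f y v * partial1 g y v) + f x v * partial2 g x v -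
    f 0 v * partial2 g 0 v - ∫ y in (0 : ℝ)..x, partial1 f y v * partial2 g y v

variable {f g : ℝ → ℝ → ℝ}

lemma continuous_intervalIntegral_prod {h : ℝ → ℝ → ℝ}
    (hh : Continuous fun p : ℝ × ℝ => h p.1 p.2) :
    Continuous fun p : ℝ × ℝ => ∫ y in (0 : ℝ)..p.1, h y p.2 :=
  intervalIntegral.continuous_parametric_intervalIntegral_of_continuous
    (f := fun (p : ℝ × ℝ) y => h y p.2)
    (hh.comp (f := fun q : (ℝ × ℝ) × ℝ => (q.2, q.1.2)) (by fun_prop)) continuous_fst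

lemma continuous_section1 {h : ℝ → ℝ → ℝ} (hh : Continuous fun p : ℝ × ℝ => h p.1 p.2) (v : ℝ) :
    Continuous fun x => h x v :=
  hh.comp (f := fun x : ℝ => (x, v)) (by fun_prop)

lemma hasDerivAt_mulPartialPrimitive1 (hf : IsC11 f) (hg : IsC21 g) (x v : ℝ) :
    HasDerivAt (fun y => mulPartialPrimitive f g y v) (f x v * partial1 g x v) x := by
  have hc : Continuous fun y => f y v * partial1 g y v :=
    (continuous_section1 hf.continuous v).mul (continuous_section1 hg.continuous_partial1 v)
  exact intervalIntegral.integral_hasDerivAt_right (hc.intervalIntegrable _ _)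
    (hc.stronglyMeasurableAtFilter _ _) hc.continuousAt

/-- The increment of `f g₁'` in `v` has a part containing the increment of `g₁'`. Integration by
parts in `y` moves the derivative onto `f`, so only increments of `f` and `g` remain, and each
yields a factor `w - v`. -/
lemma mulPartialPrimitive_sub (hf : IsC11 f) (hg : IsC21 g) (x v w : ℝ) :
    mulPartialPrimitive f g x w - mulPartialPrimitive f g x v = (w - v) *
      ((∫ y in (0 : ℝ)..x, dividedDiff2 f y v w * partial1 g y w) + f x v * dividedDiff2 g x v w -
        f 0 v * dividedDiff2 g 0 v w - ∫ y in (0 : ℝ)..x, partial1 f y v * dividedDiff2 g y v w) := by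
  have cf : ∀ u, Continuous fun y => f y u := continuous_section1 hf.continuous
  have cf1 : ∀ u, Continuous fun y => partial1 f y u := continuous_section1 hf.continuous_partial1
  have cg1 : ∀ u, Continuous fun y => partial1 g y u := continuous_section1 hg.continuous_partial1
  have parts := intervalIntegral.integral_mul_deriv_eq_deriv_mul (a := 0) (b := x)
    (u := fun y => f y v) (u' := fun y => partial1 f y v)
    (v := fun y => g y w - g y v) (v' := fun y => partial1 g y w - partial1 g y v)
    (fun y _ => hf.hasDerivAt1 y v) (fun y _ => (hg.hasDerivAt1 y w).sub (hg.hasDerivAt1 y v))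
    ((cf1 v).intervalIntegrable _ _) (((cg1 w).sub (cg1 v)).intervalIntegrable _ _)
  have e1 : (w - v) * ∫ y in (0 : ℝ)..x, dividedDiff2 f y v w * partial1 g y w =
      ∫ y in (0 : ℝ)..x, (f y w - f y v) * partial1 g y w := by
    rw [← intervalIntegral.integral_const_mul]
    refine intervalIntegral.integral_congr fun y _ => ?_
    simp only [hf.dividedDiff2_mul]
    ring
  have e2 : (w - v) * ∫ y in (0 : ℝ)..x, partial1 f y v * dividedDiff2 g y v w =
      ∫ y in (0 : ℝ)..x, partial1 f y v * (g y w - g y v) := by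
    rw [← intervalIntegral.integral_const_mul]
    refine intervalIntegral.integral_congr fun y _ => ?_
    simp only [hg.dividedDiff2_mul]
    ring
  have e3 : mulPartialPrimitive f g x w - mulPartialPrimitive f g x v =
      (∫ y in (0 : ℝ)..x, (f y w - f y v) * partial1 g y w) +
      ∫ y in (0 : ℝ)..x, f y v * (partial1 g y w - partial1 g y v) := by
    unfold mulPartialPrimitive
    have i1 : ∀ u, IntervalIntegrable (fun y => f y u * partial1 g y u) volume 0 x := fun u =>
      ((cf u).mul (cg1 u)).intervalIntegrable _ _
    have i2 : IntervalIntegrable (fun y => (f y w - f y v) * partial1 g y w) volume 0 x :=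
      (((cf w).sub (cf v)).mul (cg1 w)).intervalIntegrable _ _
    have i3 : IntervalIntegrable (fun y => f y v * (partial1 g y w - partial1 g y v)) volume 0 x :=
      ((cf v).mul ((cg1 w).sub (cg1 v))).intervalIntegrable _ _
    rw [← intervalIntegral.integral_sub (i1 w) (i1 v), ← intervalIntegral.integral_add i2 i3]
    exact intervalIntegral.integral_congr fun y _ => by ring
  rw [e3, parts, hg.dividedDiff2_mul x v w, hg.dividedDiff2_mul 0 v w, ← e1, ← e2]
  ring

/-- Carathéodory's form of differentiability, which avoids differentiating under the integral sign.
-/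
lemma hasDerivAt_of_sub_eq_mul {φ a : ℝ → ℝ} {v : ℝ} (h : ∀ w, φ w - φ v = (w - v) * a w)
    (ha : ContinuousAt a v) : HasDerivAt φ (a v) v := by
  rw [hasDerivAt_iff_tendsto_slope]
  refine (ha.tendsto.mono_left nhdsWithin_le_nhds).congr' ?_
  filter_upwards [self_mem_nhdsWithin] with w hw
  have : w - v ≠ 0 := sub_ne_zero.2 hw
  rw [slope_def_field, h]
  field_simp

lemma hasDerivAt_mulPartialPrimitive2 (hf : IsC11 f) (hg : IsC21 g) (x v : ℝ) :
    HasDerivAt (fun w => mulPartialPrimitive f g x w) (mulPartialPrimitive2 f g x v) v := by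
  refine (hasDerivAt_of_sub_eq_mul (mulPartialPrimitive_sub hf hg x v) ?_).congr_deriv ?_
  · have c1 : Continuous fun p : ℝ × ℝ => dividedDiff2 f p.1 v p.2 * partial1 g p.1 p.2 :=
      (hf.continuous_dividedDiff2 v).mul hg.continuous_partial1
    have c2 : Continuous fun p : ℝ × ℝ => partial1 f p.1 v * dividedDiff2 g p.1 v p.2 :=
      ((continuous_section1 hf.continuous_partial1 v).comp continuous_fst).mul
        (hg.continuous_dividedDiff2 v)
    have s1 : Continuous fun w => ∫ y in (0 : ℝ)..x, dividedDiff2 f y v w * partial1 g y w :=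
      (continuous_intervalIntegral_prod (h := fun y w => dividedDiff2 f y v w * partial1 g y w)
        c1).comp (Continuous.prodMk_right x)
    have s2 : Continuous fun w => ∫ y in (0 : ℝ)..x, partial1 f y v * dividedDiff2 g y v w :=
      (continuous_intervalIntegral_prod (h := fun y w => partial1 f y v * dividedDiff2 g y v w)
        c2).comp (Continuous.prodMk_right x)
    have s3 : ∀ z : ℝ, Continuous fun w => dividedDiff2 g z v w := fun z =>
      (hg.continuous_dividedDiff2 v).comp (Continuous.prodMk_right z)
    exact (((s1.add (continuous_const.mul (s3 x))).sub (continuous_const.mul (s3 0))).sub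
      s2).continuousAt
  · simp only [dividedDiff2_self, mulPartialPrimitive2]

lemma partial1_mulPartialPrimitive (hf : IsC11 f) (hg : IsC21 g) :
    partial1 (mulPartialPrimitive f g) = fun x v => f x v * partial1 g x v := by
  ext x v
  exact (hasDerivAt_mulPartialPrimitive1 hf hg x v).deriv

lemma partial2_mulPartialPrimitive (hf : IsC11 f) (hg : IsC21 g) :
    partial2 (mulPartialPrimitive f g) = mulPartialPrimitive2 f g := by
  ext x v
  exact (hasDerivAt_mulPartialPrimitive2 hf hg x v).deriv

lemma hasDerivAt_mul_partial1 (hf : IsC11 f) (hg : IsC21 g) (x v : ℝ) :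
    HasDerivAt (fun y => f y v * partial1 g y v)
      (partial1 f x v * partial1 g x v + f x v * partial1 (partial1 g) x v) x :=
  (hf.hasDerivAt1 x v).mul (hg.hasDerivAt11 x v)

lemma continuous_mulPartialPrimitive2 (hf : IsC11 f) (hg : IsC21 g) :
    Continuous fun p : ℝ × ℝ => mulPartialPrimitive2 f g p.1 p.2 := by
  have z : ∀ {h : ℝ → ℝ → ℝ}, Continuous (fun p : ℝ × ℝ => h p.1 p.2) →
      Continuous fun p : ℝ × ℝ => h 0 p.2 := fun hh =>
    hh.comp (f := fun p : ℝ × ℝ => ((0 : ℝ), p.2)) (by fun_prop)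
  exact (((continuous_intervalIntegral_prod (h := fun y v => partial2 f y v * partial1 g y v)
    (hf.continuous_partial2.mul hg.continuous_partial1)).add
    (hf.continuous.mul hg.continuous_partial2)).sub
    ((z hf.continuous).mul (z hg.continuous_partial2))).sub
    (continuous_intervalIntegral_prod (h := fun y v => partial1 f y v * partial2 g y v)
    (hf.continuous_partial1.mul hg.continuous_partial2))

/-- `∫₀ˣ f(y,v) g₁'(y,v) dy` is of class `C^{2,1}`, although `g₁'` need not be differentiable in
the second variable. -/
theorem isC21_mulPartialPrimitive (hf : IsC11 f) (hg : IsC21 g) :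
    IsC21 (mulPartialPrimitive f g) where
  differentiable1 v x := (hasDerivAt_mulPartialPrimitive1 hf hg x v).differentiableAt
  differentiable2 x v := (hasDerivAt_mulPartialPrimitive2 hf hg x v).differentiableAt
  continuous := continuous_intervalIntegral_prod (h := fun y v => f y v * partial1 g y v)
    (hf.continuous.mul hg.continuous_partial1)
  continuous_partial1 := by
    rw [partial1_mulPartialPrimitive hf hg]
    exact hf.continuous.mul hg.continuous_partial1
  continuous_partial2 := by
    rw [partial2_mulPartialPrimitive hf hg]
    exact continuous_mulPartialPrimitive2 hf hg
  differentiable11 v x := by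
    rw [partial1_mulPartialPrimitive hf hg]
    exact (hasDerivAt_mul_partial1 hf hg x v).differentiableAt
  continuous_partial11 := by
    rw [partial1_mulPartialPrimitive hf hg]
    have : (fun p : ℝ × ℝ => partial1 (fun x v => f x v * partial1 g x v) p.1 p.2) = fun p =>
        partial1 f p.1 p.2 * partial1 g p.1 p.2 + f p.1 p.2 * partial1 (partial1 g) p.1 p.2 := by
      ext p
      exact (hasDerivAt_mul_partial1 hf hg p.1 p.2).deriv
    rw [this]
    exact (hf.continuous_partial1.mul hg.continuous_partial1).add
      (hf.continuous.mul hg.continuous_partial11)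

end Antiderivative

/-! ### Convergence in probability of the defect sums and the final formula. -/

section Convergence

variable {T : ℝ}

lemma IntervalPartition.sum_abs_sub_le (π : IntervalPartition T) {v : ℝ → ℝ}
    (hv : BoundedVariationOn v (Set.Icc 0 T)) :
    ∑ k ∈ Finset.range π.num, |v (π.pt (k + 1)) - v (π.pt k)| ≤
      (eVariationOn v (Set.Icc 0 T)).toReal := by
  have h := eVariationOn.sum_le_of_monotoneOn_Iic (f := v) (s := Set.Icc 0 T) (n := π.num)
    (u := π.pt) (fun k _ l hl hkl => π.pt_mono hkl hl) (fun i hi => π.pt_mem hi)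
  refine le_trans (le_of_eq ?_) (ENNReal.toReal_mono hv h)
  rw [ENNReal.toReal_sum fun k _ => edist_ne_top _ _]
  exact Finset.sum_congr rfl fun k _ => by rw [edist_dist, ENNReal.toReal_ofReal dist_nonneg,
    Real.dist_eq]

lemma IsSmallDefect.neg {E : ℝ → ℝ → ℝ → ℝ → ℝ} (hE : IsSmallDefect E) :
    IsSmallDefect fun x v y w => -E x v y w := by
  intro R ε hε
  obtain ⟨δ, hδ, h⟩ := hE R ε hε
  exact ⟨δ, hδ, fun x v y w hx hv hy hw h1 h2 => by
    rw [abs_neg]; exact h x v y w hx hv hy hw h1 h2⟩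

lemma IsSmallDefect.add {E E' : ℝ → ℝ → ℝ → ℝ → ℝ} (hE : IsSmallDefect E)
    (hE' : IsSmallDefect E') : IsSmallDefect fun x v y w => E x v y w + E' x v y w := by
  intro R ε hε
  obtain ⟨δ, hδ, h⟩ := hE R (ε / 2) (half_pos hε)
  obtain ⟨δ', hδ', h'⟩ := hE' R (ε / 2) (half_pos hε)
  refine ⟨min δ δ', lt_min hδ hδ', fun x v y w hx hv hy hw h1 h2 => ?_⟩
  have a := h x v y w hx hv hy hw (h1.trans_le (min_le_left _ _)) (h2.trans_le (min_le_left _ _))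
  have b := h' x v y w hx hv hy hw (h1.trans_le (min_le_right _ _))
    (h2.trans_le (min_le_right _ _))
  linarith [abs_add_le (E x v y w) (E' x v y w)]

/-- The sum of a defect along a partition. -/
noncomputable def defectSum (E : ℝ → ℝ → ℝ → ℝ → ℝ) (π : IntervalPartition T) (x v : ℝ → ℝ) : ℝ :=
  ∑ k ∈ Finset.range π.num, E (x (π.pt k)) (v (π.pt k)) (x (π.pt (k + 1))) (v (π.pt (k + 1)))

/-- The sum of the squared increments along a partition. -/
noncomputable def sumSq (π : IntervalPartition T) (x : ℝ → ℝ) : ℝ :=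
  ∑ k ∈ Finset.range π.num, (x (π.pt (k + 1)) - x (π.pt k)) ^ 2

/-- A pathwise bound: a continuous path stays in a compact set, its increments are eventually below
the threshold of the defect, and the variation of `v` bounds the sum of the `|Δv|`. -/
lemma IsSmallDefect.abs_defectSum_le {E : ℝ → ℝ → ℝ → ℝ → ℝ} (hE : IsSmallDefect E)
    {x v : ℝ → ℝ} (hx : ContinuousOn x (Set.Icc 0 T)) (hv : ContinuousOn v (Set.Icc 0 T))
    (hbv : BoundedVariationOn v (Set.Icc 0 T)) {ε : ℝ} (hε : 0 < ε) :
    ∃ δ > 0, ∀ π : IntervalPartition T, π.mesh < δ →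
      |defectSum E π x v| ≤ ε * (sumSq π x + 1) := by
  set W := (eVariationOn v (Set.Icc 0 T)).toReal with hW
  have hW0 : 0 ≤ W := ENNReal.toReal_nonneg
  obtain ⟨Rx, hRx⟩ := isCompact_Icc.exists_bound_of_continuousOn hx
  obtain ⟨Rv, hRv⟩ := isCompact_Icc.exists_bound_of_continuousOn hv
  have hx' : ∀ t ∈ Set.Icc 0 T, |x t| ≤ max Rx Rv := fun t ht => (hRx t ht).trans (le_max_left _ _)
  have hv' : ∀ t ∈ Set.Icc 0 T, |v t| ≤ max Rx Rv := fun t ht => (hRv t ht).trans (le_max_right _ _)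
  obtain ⟨δ, hδ, h⟩ := hE (max Rx Rv) (ε / (W + 1)) (by positivity)
  obtain ⟨δx, hδx, hx''⟩ := IntervalPartition.exists_increment_lt hx hδ
  obtain ⟨δv, hδv, hv''⟩ := IntervalPartition.exists_increment_lt hv hδ
  refine ⟨min δx δv, lt_min hδx hδv, fun π hπ => ?_⟩
  have hQ : 0 ≤ sumSq π x := Finset.sum_nonneg fun _ _ => sq_nonneg _
  calc |defectSum E π x v| ≤ ∑ k ∈ Finset.range π.num,
        |E (x (π.pt k)) (v (π.pt k)) (x (π.pt (k + 1))) (v (π.pt (k + 1)))| :=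
        Finset.abs_sum_le_sum_abs _ _
    _ ≤ ∑ k ∈ Finset.range π.num, ε / (W + 1) * ((x (π.pt (k + 1)) - x (π.pt k)) ^ 2 +
          |v (π.pt (k + 1)) - v (π.pt k)|) := by
        refine Finset.sum_le_sum fun k hk => ?_
        have hk := Finset.mem_range.1 hk
        have m1 := π.pt_mem hk.le
        have m2 := π.pt_mem (Nat.succ_le_of_lt hk)
        exact h _ _ _ _ (hx' _ m1) (hv' _ m1) (hx' _ m2) (hv' _ m2)
          (hx'' π (hπ.trans_le (min_le_left _ _)) k hk)
          (hv'' π (hπ.trans_le (min_le_right _ _)) k hk)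
    _ = ε / (W + 1) * (sumSq π x + ∑ k ∈ Finset.range π.num, |v (π.pt (k + 1)) - v (π.pt k)|) := by
        rw [← Finset.mul_sum, Finset.sum_add_distrib, sumSq]
    _ ≤ ε / (W + 1) * (sumSq π x + W) := by gcongr; exact π.sum_abs_sub_le hbv
    _ ≤ ε / (W + 1) * ((W + 1) * (sumSq π x + 1)) := by gcongr; nlinarith
    _ = ε * (sumSq π x + 1) := by field_simp

variable {Ω : Type*} [MeasurableSpace Ω] {P : Measure Ω}

lemma IsContinuousPathProcess.aemeasurable {μ : StochasticMeasure (Set.Icc (0 : ℝ) T) P}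
    {M : ℝ → Ω → ℝ} (hM : IsContinuousPathProcess μ M) {t : ℝ} (ht : t ∈ Set.Icc 0 T) :
    AEMeasurable (M t) P :=
  ⟨_, (AEEqFun.stronglyMeasurable _).measurable, hM.1 t ht⟩

lemma aemeasurable_comp₂ {h : ℝ → ℝ → ℝ} (hh : Continuous fun p : ℝ × ℝ => h p.1 p.2)
    {X Y : Ω → ℝ} (hX : AEMeasurable X P) (hY : AEMeasurable Y P) :
    AEMeasurable (fun ω => h (X ω) (Y ω)) P :=
  hh.measurable.comp_aemeasurable (hX.prodMk hY)

/-- The sums of a small defect along partitions with mesh tending to `0` converge to `0` in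
probability. -/
theorem IsSmallDefect.tendstoInMeasure [IsProbabilityMeasure P]
    {μ : StochasticMeasure (Set.Icc (0 : ℝ) T) P} {M V : ℝ → Ω → ℝ}
    (hM : IsContinuousPathProcess μ M) (hV : IsContinuousBVProcess P T V)
    {E : ℝ → ℝ → ℝ → ℝ → ℝ} (hE : IsSmallDefect E)
    (hEm : ∀ π : IntervalPartition T,
      AEMeasurable (fun ω => defectSum E π (fun t => M t ω) (fun t => V t ω)) P)
    (π : ℕ → IntervalPartition T) (hπ : Tendsto (fun n => (π n).mesh) atTop (𝓝 0)) :
    TendstoInMeasure P (fun n ω => defectSum E (π n) (fun t => M t ω) (fun t => V t ω)) atTop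
      (fun _ => 0) := by
  refine tendstoInMeasure_iff_measureReal_norm.2 fun ε hε => ?_
  simp only [sub_zero, Real.norm_eq_abs]
  -- It suffices to converge along each ultrafilter, so the bound `K` on the sums of squares may
  -- depend on it.
  refine (tendsto_iff_ultrafilter _ _ _).2 fun U hU => ?_
  refine Metric.tendsto_nhds.2 fun d hd => ?_
  obtain ⟨K, hK⟩ := sum_sq_increments_bounded_in_probability hM π hπ U hU (half_pos hd)
  have hQm : ∀ n, AEMeasurable (fun ω => sumSq (π n) (fun t => M t ω)) P := fun n =>
    Finset.aemeasurable_fun_sum _ fun k hk =>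
      ((hM.aemeasurable ((π n).pt_mem (Finset.mem_range.1 hk))).sub
        (hM.aemeasurable ((π n).pt_mem (Finset.mem_range.1 hk).le))).pow_const 2
  -- Where the sum of squares is at most `K`, the pathwise bound makes the defect sum eventually at
  -- most `ε/2`.
  have hZ : Tendsto (fun n => P.real ({ω | ε ≤ |defectSum E (π n) (fun t => M t ω) fun t => V t ω|} ∩
      {ω | sumSq (π n) (fun t => M t ω) ≤ K})) atTop (𝓝 0) := by
    refine tendsto_measureReal_zero_of_ae_eventually_notMem (fun n => ?_) ?_
    · exact (nullMeasurableSet_le aemeasurable_const (hEm (π n)).abs).inter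
        (nullMeasurableSet_le (hQm n) aemeasurable_const)
    · filter_upwards [hM.2, hV.2] with ω h1 h2
      obtain ⟨δ, hδ, h⟩ := hE.abs_defectSum_le h1 h2.1 h2.2 (ε := ε / (2 * (|K| + 1)))
        (by positivity)
      filter_upwards [hπ.eventually (gt_mem_nhds hδ)] with n hn
      rintro ⟨ha, hb⟩
      change ε ≤ |_| at ha
      change sumSq _ _ ≤ K at hb
      have h3 := h (π n) hn
      have h4 : ε / (2 * (|K| + 1)) * (sumSq (π n) (fun t => M t ω) + 1) ≤
          ε / (2 * (|K| + 1)) * (|K| + 1) := by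
        gcongr
        exact hb.trans (le_abs_self K)
      have h5 : ε / (2 * (|K| + 1)) * (|K| + 1) = ε / 2 := by field_simp
      linarith
  filter_upwards [hK, (hZ.mono_left hU).eventually (gt_mem_nhds (half_pos hd))] with n h1 h2
  rw [dist_zero_right, Real.norm_of_nonneg measureReal_nonneg]
  have h3 : P.real {ω | ε ≤ |defectSum E (π n) (fun t => M t ω) fun t => V t ω|} ≤
      P.real ({ω | ε ≤ |defectSum E (π n) (fun t => M t ω) fun t => V t ω|} ∩
      {ω | sumSq (π n) (fun t => M t ω) ≤ K}) + P.real {ω | K < sumSq (π n) (fun t => M t ω)} := by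
    refine (measureReal_mono ?_).trans (measureReal_union_le _ _)
    intro ω hω
    rcases le_or_gt (sumSq (π n) (fun t => M t ω)) K with h | h
    · exact Or.inl ⟨hω, h⟩
    · exact Or.inr h
  have h4 : P.real {ω | K < sumSq (π n) (fun t => M t ω)} < d / 2 := h1
  linarith

lemma TendstoInMeasure.add_real [IsFiniteMeasure P] {X Y : ℕ → Ω → ℝ} {x y : Ω → ℝ}
    (hX : TendstoInMeasure P X atTop x) (hY : TendstoInMeasure P Y atTop y) :
    TendstoInMeasure P (fun n ω => X n ω + Y n ω) atTop (fun ω => x ω + y ω) := by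
  refine tendstoInMeasure_iff_measureReal_norm.2 fun ε hε => ?_
  have h := (tendstoInMeasure_iff_measureReal_norm.1 hX (ε / 2) (half_pos hε)).add
    (tendstoInMeasure_iff_measureReal_norm.1 hY (ε / 2) (half_pos hε))
  rw [add_zero] at h
  refine squeeze_zero (fun _ => measureReal_nonneg) (fun n => ?_) h
  refine (measureReal_mono ?_).trans (measureReal_union_le _ _)
  intro ω hω
  change ε ≤ ‖X n ω + Y n ω - (x ω + y ω)‖ at hω
  change ε / 2 ≤ ‖X n ω - x ω‖ ∨ ε / 2 ≤ ‖Y n ω - y ω‖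
  by_contra! hcon
  have := norm_add_le (X n ω - x ω) (Y n ω - y ω)
  rw [show X n ω - x ω + (Y n ω - y ω) = X n ω + Y n ω - (x ω + y ω) by ring] at this
  linarith [hcon.1, hcon.2]

/-- The partition into `n + 1` intervals of equal length. -/
noncomputable def uniformPartition (hT : 0 < T) (n : ℕ) : IntervalPartition T where
  num := n + 1
  pt k := k * (T / (n + 1))
  pt_zero := by simp
  pt_num := by push_cast; field_simp
  pt_lt k _ := by
    have : 0 < T / (n + 1) := by positivity
    push_cast
    linarith

lemma tendsto_mesh_uniformPartition (hT : 0 < T) :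
    Tendsto (fun n => (uniformPartition hT n).mesh) atTop (𝓝 0) := by
  have h : ∀ n, (uniformPartition hT n).mesh = T * (1 / ((n : ℝ) + 1)) := by
    intro n
    have : ∀ k : Fin (uniformPartition hT n).num, (uniformPartition hT n).pt (k + 1) -
        (uniformPartition hT n).pt k = T * (1 / ((n : ℝ) + 1)) := fun k => by
      simp only [uniformPartition]
      push_cast
      ring
    have : Nonempty (Fin (uniformPartition hT n).num) := ⟨⟨0, Nat.succ_pos n⟩⟩
    simp only [IntervalPartition.mesh, *, ciSup_const]
  simp only [h]
  simpa using tendsto_one_div_add_atTop_nhds_zero_nat.const_mul T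

/-- Reduces the integral to approximants `R` converging almost surely. Measurability of `I`, which
may involve a chosen Stieltjes integral, follows from its being an almost sure limit along uniform
partitions. -/
lemma hasStratonovichIntegral_of_tendsto [IsProbabilityMeasure P] (hT : 0 < T)
    {ξ η : ℝ → Ω → ℝ} (R : IntervalPartition T → Ω → ℝ) {I : Ω → ℝ}
    (hR : ∀ π, AEMeasurable (R π) P)
    (h : ∀ π : ℕ → IntervalPartition T, Tendsto (fun n => (π n).mesh) atTop (𝓝 0) →
      TendstoInMeasure P (fun n ω => stratonovichSum ξ η (π n) ω - R (π n) ω) atTop (fun _ => 0))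
    (hI : ∀ π : ℕ → IntervalPartition T, Tendsto (fun n => (π n).mesh) atTop (𝓝 0) →
      ∀ᵐ ω ∂P, Tendsto (fun n => R (π n) ω) atTop (𝓝 (I ω))) :
    HasStratonovichIntegral P T ξ η I := by
  refine ⟨aemeasurable_of_tendsto_metrizable_ae atTop (fun n => hR (uniformPartition hT n))
    (hI _ (tendsto_mesh_uniformPartition hT)), fun π hπ => ?_⟩
  have h2 : TendstoInMeasure P (fun n => R (π n)) atTop I :=
    tendstoInMeasure_of_tendsto_ae (fun n => (hR (π n)).aestronglyMeasurable) (hI π hπ)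
  have h3 := TendstoInMeasure.add_real (h π hπ) h2
  simpa using h3

lemma HasStieltjesIntegral.tendsto {φ v : ℝ → ℝ} {S : ℝ} (h : HasStieltjesIntegral T φ v S)
    (π : ℕ → IntervalPartition T) (hπ : Tendsto (fun n => (π n).mesh) atTop (𝓝 0)) :
    Tendsto (fun n => ∑ k ∈ Finset.range (π n).num, φ ((π n).pt k) *
      (v ((π n).pt (k + 1)) - v ((π n).pt k))) atTop (𝓝 S) := by
  refine Metric.tendsto_nhds.2 fun ε hε => ?_
  obtain ⟨δ, hδ, H⟩ := h ε hε
  filter_upwards [hπ.eventually (gt_mem_nhds hδ)] with n hn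
  exact H (π n) hn (π n).pt fun k hk => ⟨le_rfl, ((π n).pt_lt k hk).le⟩

open Classical in
/-- The value of the Riemann–Stieltjes integral, if it exists. -/
noncomputable def stieltjesIntegral (T : ℝ) (φ v : ℝ → ℝ) : ℝ :=
  if h : ∃ S, HasStieltjesIntegral T φ v S then h.choose else 0

lemma ae_hasStieltjesIntegral (hT : 0 < T) {μ : StochasticMeasure (Set.Icc (0 : ℝ) T) P}
    {M V : ℝ → Ω → ℝ} (hM : IsContinuousPathProcess μ M) (hV : IsContinuousBVProcess P T V)
    {h : ℝ → ℝ → ℝ} (hh : Continuous fun p : ℝ × ℝ => h p.1 p.2) :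
    ∀ᵐ ω ∂P, HasStieltjesIntegral T (fun t => h (M t ω) (V t ω)) (fun t => V t ω)
      (stieltjesIntegral T (fun t => h (M t ω) (V t ω)) (fun t => V t ω)) := by
  filter_upwards [hM.2, hV.2] with ω h1 h2
  have hex : ∃ S, HasStieltjesIntegral T (fun t => h (M t ω) (V t ω)) (fun t => V t ω) S :=
    exists_hasStieltjesIntegral hT (hh.comp_continuousOn (h1.prodMk h2.1)) h2.1 h2.2
  rw [stieltjesIntegral, dif_pos hex]
  exact hex.choose_spec

end Convergence

theorem mainTheorem2 {Ω : Type*} [MeasurableSpace Ω] (P : Measure Ω) [IsProbabilityMeasure P]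
    (T : ℝ) (hT : 0 < T)
    (μ : StochasticMeasure (Set.Icc (0 : ℝ) T) P)
    (M : ℝ → Ω → ℝ) (hM : IsContinuousPathProcess μ M)
    (V : ℝ → Ω → ℝ) (hV : IsContinuousBVProcess P T V)
    (f g : ℝ → ℝ → ℝ) (hf : IsC11 f) (hg : IsC21 g) :
    ∃ I J S : Ω → ℝ,
      HasStratonovichIntegral P T (fun t ω => f (M t ω) (V t ω)) (fun t ω => g (M t ω) (V t ω)) I ∧
      HasStratonovichIntegral P T
        (fun t ω => f (M t ω) (V t ω) * partial1 g (M t ω) (V t ω)) M J ∧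
      (∀ᵐ ω ∂P, HasStieltjesIntegral T
        (fun t => f (M t ω) (V t ω) * partial2 g (M t ω) (V t ω)) (fun t => V t ω) (S ω)) ∧
      I =ᵐ[P] fun ω => J ω + S ω := by
  set F := mulPartialPrimitive f g with hF
  have hFC := isC21_mulPartialPrimitive hf hg
  have hF2c := hFC.continuous_partial2
  have hfg2c : Continuous fun p : ℝ × ℝ => f p.1 p.2 * partial2 g p.1 p.2 :=
    hf.continuous.mul hg.continuous_partial2
  have hF1 : ∀ x v, partial1 F x v = f x v * partial1 g x v := fun x v => by
    rw [hF, partial1_mulPartialPrimitive hf hg]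
  have hsF := ae_hasStieltjesIntegral hT hM hV (h := partial2 F) hF2c
  have hsS := ae_hasStieltjesIntegral hT hM hV
    (h := fun x v => f x v * partial2 g x v) hfg2c
  set SF : Ω → ℝ := fun ω => stieltjesIntegral T (fun t => partial2 F (M t ω) (V t ω))
    (fun t => V t ω)
  set S : Ω → ℝ := fun ω => stieltjesIntegral T
    (fun t => f (M t ω) (V t ω) * partial2 g (M t ω) (V t ω)) (fun t => V t ω)
  -- The value dictated by the chain rule for `F`, since `F₁' = f g₁'`.
  set J : Ω → ℝ := fun ω => F (M T ω) (V T ω) - F (M 0 ω) (V 0 ω) - SF ω with hJ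
  have m : ∀ {h : ℝ → ℝ → ℝ}, Continuous (fun p : ℝ × ℝ => h p.1 p.2) → ∀ {t}, t ∈ Set.Icc 0 T →
      AEMeasurable (fun ω => h (M t ω) (V t ω)) P := fun hh _ ht =>
    aemeasurable_comp₂ hh (hM.aemeasurable ht) (hV.1 _ ht)
  have mS : ∀ {h : ℝ → ℝ → ℝ}, Continuous (fun p : ℝ × ℝ => h p.1 p.2) →
      ∀ π : IntervalPartition T, AEMeasurable (fun ω => ∑ k ∈ Finset.range π.num,
        h (M (π.pt k) ω) (V (π.pt k) ω) * (V (π.pt (k + 1)) ω - V (π.pt k) ω)) P := fun hh π =>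
    Finset.aemeasurable_fun_sum _ fun k hk =>
      (m hh (π.pt_mem (Finset.mem_range.1 hk).le)).mul
        ((hV.1 _ (π.pt_mem (Finset.mem_range.1 hk))).sub
          (hV.1 _ (π.pt_mem (Finset.mem_range.1 hk).le)))
  have mStr : ∀ {ξ η : ℝ → Ω → ℝ}, (∀ t ∈ Set.Icc 0 T, AEMeasurable (ξ t) P) →
      (∀ t ∈ Set.Icc 0 T, AEMeasurable (η t) P) → ∀ π : IntervalPartition T,
      AEMeasurable (stratonovichSum ξ η π) P := fun hξ hη π =>
    Finset.aemeasurable_fun_sum _ fun k hk => by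
      have h1 := π.pt_mem (Finset.mem_range.1 hk)
      have h0 := π.pt_mem (Finset.mem_range.1 hk).le
      exact (((hξ _ h0).add (hξ _ h1)).div_const 2).mul ((hη _ h1).sub (hη _ h0))
  set RJ : IntervalPartition T → Ω → ℝ := fun π ω => F (M T ω) (V T ω) - F (M 0 ω) (V 0 ω) -
    ∑ k ∈ Finset.range π.num, partial2 F (M (π.pt k) ω) (V (π.pt k) ω) *
      (V (π.pt (k + 1)) ω - V (π.pt k) ω) with hRJ
  set RI : IntervalPartition T → Ω → ℝ := fun π ω => RJ π ω +
    ∑ k ∈ Finset.range π.num, f (M (π.pt k) ω) (V (π.pt k) ω) *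
      partial2 g (M (π.pt k) ω) (V (π.pt k) ω) * (V (π.pt (k + 1)) ω - V (π.pt k) ω) with hRI
  have h0T : (0 : ℝ) ∈ Set.Icc 0 T := ⟨le_rfl, hT.le⟩
  have hTT : T ∈ Set.Icc 0 T := ⟨hT.le, le_rfl⟩
  have mRJ : ∀ π, AEMeasurable (RJ π) P := fun π =>
    ((m hFC.continuous hTT).sub (m hFC.continuous h0T)).sub (mS hF2c π)
  have mRI : ∀ π, AEMeasurable (RI π) P := fun π =>
    (mRJ π).add (mS (h := fun x v => f x v * partial2 g x v) hfg2c π)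
  have tel : ∀ (π : IntervalPartition T) ω, F (M T ω) (V T ω) - F (M 0 ω) (V 0 ω) =
      ∑ k ∈ Finset.range π.num, (F (M (π.pt (k + 1)) ω) (V (π.pt (k + 1)) ω) -
        F (M (π.pt k) ω) (V (π.pt k) ω)) := fun π ω => by
    rw [Finset.sum_range_sub (fun k => F (M (π.pt k) ω) (V (π.pt k) ω)), π.pt_zero, π.pt_num]
  have eJ : ∀ (π : IntervalPartition T) ω, stratonovichSum
      (fun t ω => f (M t ω) (V t ω) * partial1 g (M t ω) (V t ω)) M π ω - RJ π ω =
      defectSum (fun x v y w => -(F y w - F x v -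
        ((partial1 F x v + partial1 F y w) / 2 * (y - x) + partial2 F x v * (w - v)))) π
        (fun t => M t ω) (fun t => V t ω) := fun π ω => by
    simp only [hRJ, tel π ω, stratonovichSum, defectSum, hF1, ← Finset.sum_sub_distrib]
    exact Finset.sum_congr rfl fun k _ => by ring
  -- Two defects add up: that of replacing `f ∘ dg` by `f g₁' ∘ dx + f g₂' dv`, and that of
  -- integrating `f g₁' ∘ dx` through `F`.
  have eI : ∀ (π : IntervalPartition T) ω, stratonovichSum
      (fun t ω => f (M t ω) (V t ω)) (fun t ω => g (M t ω) (V t ω)) π ω - RI π ω =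
      defectSum (fun x v y w => ((f x v + f y w) / 2 * (g y w - g x v) -
        ((f x v * partial1 g x v + f y w * partial1 g y w) / 2 * (y - x) +
          f x v * partial2 g x v * (w - v))) + -(F y w - F x v -
        ((partial1 F x v + partial1 F y w) / 2 * (y - x) + partial2 F x v * (w - v)))) π
        (fun t => M t ω) (fun t => V t ω) := fun π ω => by
    simp only [hRI, hRJ, tel π ω, stratonovichSum, defectSum, hF1, ← Finset.sum_sub_distrib,
      ← Finset.sum_add_distrib]
    exact Finset.sum_congr rfl fun k _ => by ring
  have tJ : ∀ π : ℕ → IntervalPartition T, Tendsto (fun n => (π n).mesh) atTop (𝓝 0) →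
      ∀ᵐ ω ∂P, Tendsto (fun n => RJ (π n) ω) atTop (𝓝 (J ω)) := fun π hπ => by
    filter_upwards [hsF] with ω hω
    exact tendsto_const_nhds.sub (hω.tendsto π hπ)
  have tI : ∀ π : ℕ → IntervalPartition T, Tendsto (fun n => (π n).mesh) atTop (𝓝 0) →
      ∀ᵐ ω ∂P, Tendsto (fun n => RI (π n) ω) atTop (𝓝 (J ω + S ω)) := fun π hπ => by
    filter_upwards [tJ π hπ, hsS] with ω h1 h2
    exact h1.add (h2.tendsto π hπ)
  refine ⟨fun ω => J ω + S ω, J, S, ?_, ?_, hsS, EventuallyEq.rfl⟩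
  · refine hasStratonovichIntegral_of_tendsto hT RI mRI (fun π hπ => ?_) tI
    simp only [eI]
    refine ((hg.isSmallDefect_mul hf).add hFC.isSmallDefect.neg).tendstoInMeasure hM hV
      (fun π => ?_) π hπ
    exact ((mStr (fun t ht => m hf.continuous ht) (fun t ht => m hg.continuous ht) π).sub
      (mRI π)).congr (ae_of_all _ fun ω => eI π ω)
  · refine hasStratonovichIntegral_of_tendsto hT RJ mRJ (fun π hπ => ?_) tJ
    simp only [eJ]
    refine hFC.isSmallDefect.neg.tendstoInMeasure hM hV (fun π => ?_) π hπ
    exact ((mStr (fun t ht => m (h := fun x v => f x v * partial1 g x v)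
      (hf.continuous.mul hg.continuous_partial1) ht) (fun t ht => hM.aemeasurable ht) π).sub
      (mRJ π)).congr (ae_of_all _ fun ω => eJ π ω)
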